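/- Let $\Lambda$ be the von Mangoldt function, extended by $\Lambda(n)=0$ for integers $n\le 0$, and write $e(t)=\exp(2\pi i t)$. Let $\ell\ge 1$ and $k\ge 2$ be integers and let $a_1,\dots,a_\ell$ be distinct integers. There is a constant $C>0$, depending only on $\ell$, $k$ and $a_1,\dots,a_\ell$, such that for all real $X\ge H\ge 2$ and every function $g:\mathbb{Z}\to\mathbb{C}$ with $|g(n)|\le 1$ for all $n$, the moment $$M_{2k}:=\int_0^X\int_0^1\bigg|\sum_{x\le n\le x+H} g(n)\,e(\alpha n)\prod_{j=1}^{\ell}\Lambda(n+a_j)\bigg|^{2k}\,d\alpha\,dx$$ (the sum being over integers $n$) satisfies $$M_{2k}\le C\,X\big(H^{2k-1}+H^{k}(\log X)^{k\ell}+H(\log X)^{(2k-1)\ell}\big).$$ In particular, if moreover $H\ge(\log X)^{\ell k/(k-1)}$, then $M_{2k}\le C\,X H^{2k-1}$ (after enlarging $C$, still depending only on $\ell$, $k$ and the $a_j$). -/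

import Mathlib

noncomputable section

/-- The von Mangoldt function on the integers, extended by zero to the nonpositive integers. -/
def vonMangoldtInt (n : ℤ) : ℝ :=
  ArithmeticFunction.vonMangoldt n.toNat

/-- The additive character `e(t) = exp(2πit)`. -/
def additiveChar (t : ℝ) : ℂ :=
  Complex.exp (2 * Real.pi * Complex.I * t)

/-- The exponential sum over the integers `n` with `x ≤ n ≤ x + H` of
`g(n) e(αn) ∏ⱼ Λ(n + aⱼ)`. -/
def shortExpSum {l : ℕ} (a : Fin l → ℤ) (g : ℤ → ℂ) (H x α : ℝ) : ℂ :=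
  ∑ n ∈ Finset.Icc ⌈x⌉ ⌊x + H⌋,
    g n * additiveChar (α * n) * ∏ j : Fin l, (vonMangoldtInt (n + a j) : ℂ)

/-- The moment of order `2k` of the short exponential sums, over `0 ≤ α ≤ 1` and `0 ≤ x ≤ X`.
The inner integrand is continuous in `α` and the outer one is a step function of `x`, so both
integrals exist for all values of the parameters. -/
def shortExpSumMoment {l : ℕ} (a : Fin l → ℤ) (g : ℤ → ℂ) (k : ℕ) (X H : ℝ) : ℝ :=
  ∫ x in (0 : ℝ)..X, ∫ α in (0 : ℝ)..1, ‖shortExpSum a g H x α‖ ^ (2 * k)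

end

/-!
The `2k`-th power of the exponential sum is expanded and integrated over `α`, which leaves the
tuples `n₁, …, n_{2k}` in `[x, x + H]` with `n₁ + ⋯ + n_k = n_{k+1} + ⋯ + n_{2k}`, weighted by
`∏ F(nᵢ)`, where `F(n) = ∏ⱼ Λ(n + aⱼ)`. Writing `nᵢ = ⌈x⌉ + uᵢ` and integrating over `x` bounds the
moment by a sum of correlations `∑_{n ≤ X} ∏ᵢ F(n + uᵢ)` over the balanced `u ∈ [0, H]^{2k}`
(`shortExpSumMoment_le`).

The coordinates of `u` are grouped into `r` classes, represented by coordinates that lie more than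
a constant apart, the other coordinates being at a bounded distance from a representative. Those
others are estimated trivially, by `(log X)^l` each. The representatives give `r l` distinct
linear forms, and an upper bound sieve of dimension `r l` shows that their correlation is `O(X)` up
to the Euler factors `∏ (1 - 1/p)⁻¹` over the primes dividing the differences of the shifts
(`exists_sum_prod_vonMangoldtInt_le`). These Euler factors are bounded on average over `u`
(`exists_sum_eulerFactor_pow_le`, `exists_sum_eulerPow_patternTuples_le`). The number of `u` with a
given pattern of classes is `O(H^{r-1})` because of the balancing equation, unless that equation is
void; in this case each class has at least two elements, so `r ≤ k`, and the number is `O(H^r)`.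
The resulting terms `X H^{r-1} (log X)^{l(2k-r)}` for `r ≤ 2k`, and `X H^r (log X)^{l(2k-r)}` for
`r ≤ k`, are bounded by the three terms of the theorem (`pow_mul_pow_le_of_pattern`).

The sieve is Selberg's, in a form that needs no optimization (`IsSieve.card_unsifted_mul_sq_le`):
for each `p` the function equal to `-1` on the `s` removed classes and to `s / (p - s)` elsewhere
has mean zero, so the products of these functions over the prime factors of different `d` are
almost orthogonal. Their sum `W` over squarefree `d ≤ z` has mean square
`S = ∑ d, ∏ p ∣ d, s / (p - s)` and equals `S` on the unsifted integers, so that these have density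
at most `1 / S`. The lower bound for `S` compares it with `(∑ 1 / n) ^ s`
(`log_pow_le_prod_mul_sum_sieveWeight`).
-/

/-! ### An orthogonal form of Selberg's upper bound sieve -/

open Finset in
theorem sum_range_mul_of_periodic {f : ℕ → ℝ} {q : ℕ} (hf : Function.Periodic f q) (t : ℕ) :
    ∑ n ∈ range (t * q), f n = t * ∑ n ∈ range q, f n := by
  induction t with
  | zero => simp
  | succ t ih =>
    rw [Nat.succ_mul, Finset.sum_range_add, ih]
    have : ∀ x, f (t * q + x) = f x := fun x => by
      rw [add_comm]; exact hf.nat_mul t x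
    simp only [this]
    push_cast; ring

open Finset in
/-- The Chinese remainder theorem for sums over a full period. -/
theorem sum_range_mul_of_coprime {f h : ℕ → ℝ} {a b : ℕ} (ha : 0 < a) (hb : 0 < b)
    (hf : Function.Periodic f a) (hh : Function.Periodic h b) (hab : Nat.Coprime a b) :
    ∑ n ∈ range (a * b), f n * h n = (∑ n ∈ range a, f n) * ∑ n ∈ range b, h n := by
  rw [sum_mul_sum, ← sum_product']
  refine sum_nbij (fun n => (n % a, n % b)) ?_ ?_ ?_ ?_
  · intro n _
    simp [Nat.mod_lt _ ha, Nat.mod_lt _ hb]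
  · intro n hn m hm hnm
    simp only [coe_range, Set.mem_Iio] at hn hm
    simp only [Prod.mk.injEq] at hnm
    have := (Nat.modEq_and_modEq_iff_modEq_mul hab).1 ⟨hnm.1, hnm.2⟩
    exact this.eq_of_lt_of_lt hn hm
  · rintro ⟨i, j⟩ hij
    simp only [coe_product, coe_range, Set.mem_prod, Set.mem_Iio] at hij
    refine ⟨Nat.chineseRemainder hab i j, ?_, ?_⟩
    · simpa using Nat.chineseRemainder_lt_mul hab i j ha.ne' hb.ne'
    · have h1 := (Nat.chineseRemainder hab i j).2.1
      have h2 := (Nat.chineseRemainder hab i j).2.2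
      rw [Nat.ModEq, Nat.mod_eq_of_lt hij.1] at h1
      rw [Nat.ModEq, Nat.mod_eq_of_lt hij.2] at h2
      simp [h1, h2]
  · intro n _
    simp [hf.map_mod_nat, hh.map_mod_nat]

open Finset in
/-- A bounded function whose sum over a period vanishes has sums over initial segments bounded
by the period. -/
theorem abs_sum_range_le_of_periodic {f : ℕ → ℝ} {q : ℕ} (hf : Function.Periodic f q)
    (hq : 0 < q) (h0 : ∑ n ∈ range q, f n = 0) (h1 : ∀ n, |f n| ≤ 1) (N : ℕ) :
    |∑ n ∈ range N, f n| ≤ q := by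
  rw [← Nat.div_add_mod' N q, sum_range_add, sum_range_mul_of_periodic hf, h0, mul_zero, zero_add]
  refine (abs_sum_le_sum_abs _ _).trans ((sum_le_sum fun i _ => h1 _).trans ?_)
  simpa using (Nat.mod_lt N hq).le

open Finset in
theorem sum_range_le_of_periodic {f : ℕ → ℝ} {q : ℕ} (hf : Function.Periodic f q)
    (hq : 0 < q) (h0 : ∀ n, 0 ≤ f n) (N : ℕ) :
    ∑ n ∈ range N, f n ≤ ((N : ℝ) / q + 1) * ∑ n ∈ range q, f n := by
  have hlt : N ≤ (N / q + 1) * q := by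
    rw [mul_comm]; exact (Nat.lt_mul_div_succ N hq).le
  calc ∑ n ∈ range N, f n ≤ ∑ n ∈ range ((N / q + 1) * q), f n :=
        sum_le_sum_of_subset_of_nonneg (range_mono hlt) fun i _ _ => h0 i
    _ = ((N / q + 1 : ℕ) : ℝ) * ∑ n ∈ range q, f n := sum_range_mul_of_periodic hf _
    _ ≤ _ := by
        refine mul_le_mul_of_nonneg_right ?_ (sum_nonneg fun i _ => h0 i)
        push_cast
        gcongr
        exact Nat.cast_div_le

open Classical in
/-- A sieve datum: for each prime `p` of the finite set `P`, the predicate `hit p` selects exactly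
`s` residue classes modulo `p`, which are to be removed; moreover `1 ≤ s ≤ p / 2`. -/
structure IsSieve (P : Finset ℕ) (s : ℕ) (hit : ℕ → ℕ → Prop) : Prop where
  one_le : 1 ≤ s
  prime : ∀ p ∈ P, p.Prime
  two_mul_le : ∀ p ∈ P, 2 * s ≤ p
  periodic : ∀ p ∈ P, ∀ n, hit p (n + p) ↔ hit p n
  card : ∀ p ∈ P, ((Finset.range p).filter (hit p)).card = s

open Classical in
/-- The function modulo `p` equal to `-1` on the `s` removed classes and to the constant
`s / (p - s)` on the others; this constant makes its mean value zero, and its mean square is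
again `s / (p - s)`. -/
noncomputable def sieveTheta (hit : ℕ → ℕ → Prop) (s p n : ℕ) : ℝ :=
  if hit p n then -1 else (s : ℝ) / (p - s)

/-- The multiplicative function `∏_{p ∣ d} s / (p - s)` of Selberg's sieve of dimension `s`. -/
noncomputable def sieveWeight (s d : ℕ) : ℝ := ∏ p ∈ d.primeFactors, (s : ℝ) / (p - s)

open Classical in
/-- The integers `1 ≤ d ≤ z`, squarefree, all of whose prime factors lie in `P`. -/
noncomputable def sieveSupport (P : Finset ℕ) (z : ℕ) : Finset ℕ :=
  (Finset.Icc 1 z).filter fun d => Squarefree d ∧ d.primeFactors ⊆ P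

namespace IsSieve

open Finset

variable {P : Finset ℕ} {s : ℕ} {hit : ℕ → ℕ → Prop}

theorem sub_pos (h : IsSieve P s hit) {p : ℕ} (hp : p ∈ P) : (0 : ℝ) < p - s := by
  have h1 := h.two_mul_le p hp
  have h2 := h.one_le
  have : s < p := by omega
  have : (s : ℝ) < p := by exact_mod_cast this
  linarith

theorem density_pos (h : IsSieve P s hit) {p : ℕ} (hp : p ∈ P) : (0 : ℝ) < s / (p - s) :=
  div_pos (by exact_mod_cast h.one_le) (h.sub_pos hp)

theorem density_le_one (h : IsSieve P s hit) {p : ℕ} (hp : p ∈ P) : (s : ℝ) / (p - s) ≤ 1 := by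
  rw [div_le_one (h.sub_pos hp)]
  have h1 : ((2 * s : ℕ) : ℝ) ≤ p := by exact_mod_cast h.two_mul_le p hp
  push_cast at h1
  linarith

theorem abs_theta_le (h : IsSieve P s hit) {p : ℕ} (hp : p ∈ P) (n : ℕ) :
    |sieveTheta hit s p n| ≤ 1 := by
  unfold sieveTheta
  split_ifs
  · simp
  · rw [abs_of_pos (h.density_pos hp)]; exact h.density_le_one hp

theorem periodic_theta (h : IsSieve P s hit) {p : ℕ} (hp : p ∈ P) :
    Function.Periodic (sieveTheta hit s p) p := fun n => by
  classical exact if_congr (h.periodic p hp n) rfl rfl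

theorem sum_theta_aux (h : IsSieve P s hit) {p : ℕ} (hp : p ∈ P) (u v : ℝ) :
    (∑ n ∈ range p, open Classical in if hit p n then u else v) = s * u + (p - s) * v := by
  classical
  have h1 := Finset.card_filter_add_card_filter_not (s := range p) (hit p)
  rw [h.card p hp, card_range] at h1
  have h2 : (((range p).filter fun n => ¬ hit p n).card : ℝ) = p - s := by
    rw [eq_sub_iff_add_eq']; exact_mod_cast h1
  rw [sum_ite, sum_const, sum_const, h.card p hp, nsmul_eq_mul, nsmul_eq_mul, h2]

theorem sum_theta (h : IsSieve P s hit) {p : ℕ} (hp : p ∈ P) :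
    ∑ n ∈ range p, sieveTheta hit s p n = 0 := by
  have := h.sum_theta_aux hp (-1) ((s : ℝ) / (p - s))
  unfold sieveTheta
  rw [this]
  have := (h.sub_pos hp).ne'
  field_simp
  ring

theorem sum_theta_sq (h : IsSieve P s hit) {p : ℕ} (hp : p ∈ P) :
    ∑ n ∈ range p, sieveTheta hit s p n ^ 2 = p * ((s : ℝ) / (p - s)) := by
  have := h.sum_theta_aux hp 1 (((s : ℝ) / (p - s)) ^ 2)
  have e : ∀ n, sieveTheta hit s p n ^ 2 =
      open Classical in if hit p n then 1 else ((s : ℝ) / (p - s)) ^ 2 := fun n => by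
    unfold sieveTheta; split_ifs <;> simp
  simp only [e]
  rw [this]
  have := (h.sub_pos hp).ne'
  field_simp
  ring

theorem periodic_prod (h : IsSieve P s hit) {I : Finset ℕ} (hI : I ⊆ P) {q : ℕ}
    (hq : ∀ p ∈ I, p ∣ q) : Function.Periodic (fun n => ∏ p ∈ I, sieveTheta hit s p n) q := by
  intro n
  refine prod_congr rfl fun p hp => ?_
  obtain ⟨t, rfl⟩ := hq p hp
  rw [mul_comm]
  exact (h.periodic_theta (hI hp)).nat_mul t n

theorem abs_prod_le (h : IsSieve P s hit) {I : Finset ℕ} (hI : I ⊆ P) (n : ℕ) :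
    |∏ p ∈ I, sieveTheta hit s p n| ≤ 1 := by
  rw [abs_prod]
  exact prod_le_one (fun _ _ => abs_nonneg _) fun p hp => h.abs_theta_le (hI hp) n

theorem coprime_prod (h : IsSieve P s hit) {I : Finset ℕ} (hI : I ⊆ P) {p : ℕ} (hp : p ∈ P)
    (hpI : p ∉ I) : Nat.Coprime p (∏ q ∈ I, q) := by
  refine Nat.Coprime.prod_right fun q hq => ?_
  exact (Nat.coprime_primes (h.prime p hp) (h.prime q (hI hq))).2 fun e => hpI (e ▸ hq)

theorem prod_pos (h : IsSieve P s hit) {I : Finset ℕ} (hI : I ⊆ P) : 0 < ∏ q ∈ I, q :=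
  Finset.prod_pos fun q hq => (h.prime q (hI hq)).pos

theorem sum_prod_sq (h : IsSieve P s hit) {I : Finset ℕ} (hI : I ⊆ P) :
    ∑ n ∈ range (∏ p ∈ I, p), (∏ p ∈ I, sieveTheta hit s p n) ^ 2 =
      (∏ p ∈ I, (p : ℝ)) * ∏ p ∈ I, (s : ℝ) / (p - s) := by
  induction I using Finset.induction_on with
  | empty => simp
  | insert p I hpI ih =>
    have hp : p ∈ P := hI (mem_insert_self _ _)
    have hI' : I ⊆ P := (subset_insert _ _).trans hI
    simp only [prod_insert hpI, mul_pow]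
    rw [sum_range_mul_of_coprime (h.prime p hp).pos (h.prod_pos hI') _ _
      (h.coprime_prod hI' hp hpI), h.sum_theta_sq hp, ih hI']
    · ring
    · intro n; simp only; rw [h.periodic_theta hp n]
    · intro n
      have := h.periodic_prod hI' (fun p hp => dvd_prod_of_mem (fun q : ℕ => q) hp) n
      simp only at this ⊢
      rw [this]

theorem sum_prod_sq_le (h : IsSieve P s hit) {I : Finset ℕ} (hI : I ⊆ P) (N : ℕ) :
    ∑ n ∈ range N, (∏ p ∈ I, sieveTheta hit s p n) ^ 2 ≤
      (N + ∏ p ∈ I, (p : ℝ)) * ∏ p ∈ I, (s : ℝ) / (p - s) := by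
  have hq := h.prod_pos hI
  refine (sum_range_le_of_periodic (q := ∏ p ∈ I, p) ?_ hq (fun n => sq_nonneg _) N).trans ?_
  · intro n
    have := h.periodic_prod hI (fun p hp => dvd_prod_of_mem (fun q : ℕ => q) hp) n
    simp only at this ⊢
    rw [this]
  · rw [h.sum_prod_sq hI, ← mul_assoc]
    apply le_of_eq
    congr 1
    have : (∏ p ∈ I, (p : ℝ)) ≠ 0 := by rw [← Nat.cast_prod]; exact_mod_cast hq.ne'
    push_cast
    field_simp

/-- If `p ∈ I \ J`, the product of the two functions is `θ_p` times a function whose period is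
coprime to `p`, so it has mean zero over a full period. -/
theorem abs_sum_prod_mul_prod_le_aux (h : IsSieve P s hit) {I J : Finset ℕ} (hI : I ⊆ P)
    (hJ : J ⊆ P) {p : ℕ} (hpI : p ∈ I) (hpJ : p ∉ J) (N : ℕ) :
    |∑ n ∈ range N, (∏ p ∈ I, sieveTheta hit s p n) * ∏ p ∈ J, sieveTheta hit s p n| ≤
      (∏ p ∈ I, (p : ℝ)) * ∏ p ∈ J, (p : ℝ) := by
  have hp := hI hpI
  set K := I.erase p ∪ J with hK
  have hKP : K ⊆ P := union_subset ((erase_subset _ _).trans hI) hJ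
  have hpK : p ∉ K := by simp [hK, hpJ]
  have hF : Function.Periodic (fun n => (∏ p ∈ I.erase p, sieveTheta hit s p n) *
      ∏ p ∈ J, sieveTheta hit s p n) (∏ q ∈ K, q) :=
    (h.periodic_prod ((erase_subset _ _).trans hI) fun q hq =>
      dvd_prod_of_mem (fun q : ℕ => q) (mem_union_left _ hq)).mul
    (h.periodic_prod hJ fun q hq => dvd_prod_of_mem (fun q : ℕ => q) (mem_union_right _ hq))
  have hsplit : ∀ n, (∏ p ∈ I, sieveTheta hit s p n) * ∏ p ∈ J, sieveTheta hit s p n =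
      sieveTheta hit s p n * ((∏ p ∈ I.erase p, sieveTheta hit s p n) *
        ∏ p ∈ J, sieveTheta hit s p n) := fun n => by
    rw [← mul_prod_erase I _ hpI, mul_assoc]
  have hle : p * ∏ q ∈ K, q ≤ (∏ q ∈ I, q) * ∏ q ∈ J, q := by
    rw [← mul_prod_erase I _ hpI, mul_assoc]
    refine Nat.mul_le_mul_left _ ?_
    rw [← prod_union_inter]
    refine Nat.le_mul_of_pos_right _ (h.prod_pos ?_)
    exact inter_subset_right.trans hJ
  refine (abs_sum_range_le_of_periodic (q := p * ∏ q ∈ K, q) ?_ ?_ ?_ ?_ N).trans ?_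
  · intro n
    simp only [hsplit]
    have h1 : sieveTheta hit s p (n + p * ∏ q ∈ K, q) = sieveTheta hit s p n := by
      rw [mul_comm]; exact (h.periodic_theta hp).nat_mul _ n
    have h2 := hF.nat_mul p n
    simp only [Nat.cast_id] at h2
    rw [h1, h2]
  · exact Nat.mul_pos (h.prime p hp).pos (h.prod_pos hKP)
  · simp only [hsplit]
    rw [sum_range_mul_of_coprime (h.prime p hp).pos (h.prod_pos hKP) (h.periodic_theta hp) hF
      (h.coprime_prod hKP hp hpK), h.sum_theta hp, zero_mul]
  · intro n
    rw [abs_mul]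
    exact mul_le_one₀ (h.abs_prod_le hI n) (abs_nonneg _) (h.abs_prod_le hJ n)
  · rw [← Nat.cast_prod, ← Nat.cast_prod]; exact_mod_cast hle

/-- Distinct products of the functions `sieveTheta` are almost orthogonal. -/
theorem abs_sum_prod_mul_prod_le (h : IsSieve P s hit) {I J : Finset ℕ} (hI : I ⊆ P)
    (hJ : J ⊆ P) (hIJ : I ≠ J) (N : ℕ) :
    |∑ n ∈ range N, (∏ p ∈ I, sieveTheta hit s p n) * ∏ p ∈ J, sieveTheta hit s p n| ≤
      (∏ p ∈ I, (p : ℝ)) * ∏ p ∈ J, (p : ℝ) := by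
  by_cases hc : I ⊆ J
  · have : ¬ J ⊆ I := fun h' => hIJ (hc.antisymm h')
    obtain ⟨p, hpJ, hpI⟩ := not_subset.1 this
    have := h.abs_sum_prod_mul_prod_le_aux hJ hI hpJ hpI N
    rw [mul_comm]
    simpa only [mul_comm] using this
  · obtain ⟨p, hpI, hpJ⟩ := not_subset.1 hc
    exact h.abs_sum_prod_mul_prod_le_aux hI hJ hpI hpJ N

open Classical in
/-- **Selberg's upper bound sieve.** The function `W = ∑ d, ∏ p ∣ d, θ_p` is the constant
`S = ∑ d, sieveWeight s d` on the unsifted integers, while the almost orthogonality of its terms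
gives it the mean square `S`, up to the error `z ^ 4`. -/
theorem card_unsifted_mul_sq_le (h : IsSieve P s hit) (N z : ℕ) :
    (((range N).filter fun n => ∀ p ∈ P, ¬ hit p n).card : ℝ) *
      (∑ d ∈ sieveSupport P z, sieveWeight s d) ^ 2 ≤
      (N + z) * (∑ d ∈ sieveSupport P z, sieveWeight s d) + (z : ℝ) ^ 4 := by
  set D := sieveSupport P z with hD
  have hDmem : ∀ d ∈ D, (1 ≤ d ∧ d ≤ z) ∧ Squarefree d ∧ d.primeFactors ⊆ P := fun d hd => by
    simpa [hD, sieveSupport] using hd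
  have hcard : (D.card : ℝ) ≤ z := by
    have : D.card ≤ (Icc 1 z).card := card_filter_le _ _
    simpa using this
  have hprod : ∀ d ∈ D, ∏ p ∈ d.primeFactors, (p : ℝ) = d := fun d hd => by
    rw [← Nat.cast_prod, Nat.prod_primeFactors_of_squarefree (hDmem d hd).2.1]
  have hw : ∀ d ∈ D, 0 ≤ sieveWeight s d := fun d hd =>
    prod_nonneg fun p hp => (h.density_pos ((hDmem d hd).2.2 hp)).le
  set W : ℕ → ℝ := fun n => ∑ d ∈ D, ∏ p ∈ d.primeFactors, sieveTheta hit s p n with hW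
  have h1 : (((range N).filter fun n => ∀ p ∈ P, ¬ hit p n).card : ℝ) *
      (∑ d ∈ D, sieveWeight s d) ^ 2 ≤ ∑ n ∈ range N, W n ^ 2 := by
    rw [← nsmul_eq_mul, ← sum_const]
    refine (sum_le_sum fun n hn => ?_).trans
      (sum_le_sum_of_subset_of_nonneg (filter_subset _ _) fun _ _ _ => sq_nonneg _)
    apply le_of_eq
    congr 1
    refine sum_congr rfl fun d hd => prod_congr rfl fun p hp => ?_
    rw [sieveTheta, if_neg]
    exact (mem_filter.1 hn).2 p ((hDmem d hd).2.2 hp)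
  have h2 : ∑ n ∈ range N, W n ^ 2 = ∑ d ∈ D, ∑ e ∈ D, ∑ n ∈ range N,
      (∏ p ∈ d.primeFactors, sieveTheta hit s p n) *
        ∏ p ∈ e.primeFactors, sieveTheta hit s p n := by
    simp only [hW, sq, sum_mul_sum]
    rw [sum_comm]
    refine sum_congr rfl fun d _ => ?_
    rw [sum_comm]
  have h3 : ∀ d ∈ D, ∑ e ∈ D, ∑ n ∈ range N,
      (∏ p ∈ d.primeFactors, sieveTheta hit s p n) *
        ∏ p ∈ e.primeFactors, sieveTheta hit s p n ≤
      (N + z) * sieveWeight s d + z * (z : ℝ) ^ 2 := by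
    intro d hd
    rw [← add_sum_erase D _ hd]
    refine add_le_add ?_ ?_
    · have := h.sum_prod_sq_le (hDmem d hd).2.2 N
      simp only [← sq]
      refine this.trans (mul_le_mul_of_nonneg_right ?_ (hw d hd))
      rw [hprod d hd]
      have : (d : ℝ) ≤ z := by exact_mod_cast (hDmem d hd).1.2
      linarith
    · have hb : ∀ e ∈ D.erase d, ∑ n ∈ range N,
          (∏ p ∈ d.primeFactors, sieveTheta hit s p n) *
            ∏ p ∈ e.primeFactors, sieveTheta hit s p n ≤ (z : ℝ) ^ 2 := by
        intro e he
        obtain ⟨hed, he⟩ := mem_erase.1 he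
        refine (le_abs_self _).trans
          ((h.abs_sum_prod_mul_prod_le (hDmem d hd).2.2 (hDmem e he).2.2 ?_ N).trans ?_)
        · intro heq
          apply hed
          rw [← Nat.prod_primeFactors_of_squarefree (hDmem d hd).2.1, heq,
            Nat.prod_primeFactors_of_squarefree (hDmem e he).2.1]
        · rw [hprod d hd, hprod e he, sq]
          have : (d : ℝ) ≤ z := by exact_mod_cast (hDmem d hd).1.2
          have : (e : ℝ) ≤ z := by exact_mod_cast (hDmem e he).1.2
          gcongr
      refine (sum_le_card_nsmul _ _ _ hb).trans ?_
      rw [nsmul_eq_mul]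
      refine mul_le_mul_of_nonneg_right (le_trans ?_ hcard) (by positivity)
      exact_mod_cast card_le_card (erase_subset _ _)
  refine h1.trans (h2.le.trans ((sum_le_sum h3).trans ?_))
  rw [sum_add_distrib, ← mul_sum, sum_const, nsmul_eq_mul]
  have : (D.card : ℝ) * (z * (z : ℝ) ^ 2) ≤ z * (z * (z : ℝ) ^ 2) :=
    mul_le_mul_of_nonneg_right hcard (by positivity)
  nlinarith

end IsSieve

/-! ### Lower bounds for the main term of the sieve -/

section MainTerm

open Finset ArithmeticFunction

open Classical in
/-- The integers `1 ≤ n ≤ y` all of whose prime factors lie in `P`. -/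
noncomputable def factoredUpTo (P : Finset ℕ) (y : ℕ) : Finset ℕ :=
  (Icc 1 y).filter fun n => n.primeFactors ⊆ P

theorem mem_factoredUpTo {P : Finset ℕ} {y n : ℕ} :
    n ∈ factoredUpTo P y ↔ (1 ≤ n ∧ n ≤ y) ∧ n.primeFactors ⊆ P := by
  simp [factoredUpTo]

theorem geom_sum_le_inv {x : ℝ} (h0 : 0 ≤ x) (h1 : x < 1) (n : ℕ) :
    ∑ i ∈ range n, x ^ i ≤ (1 - x)⁻¹ := by
  rw [← tsum_geometric_of_lt_one h0 h1]
  exact (summable_geometric_of_lt_one h0 h1).sum_le_tsum _ fun i _ => pow_nonneg h0 i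

/-- A finite form of the Euler product: admitting the additional primes of `Q` multiplies the sum
by at most the corresponding Euler factors. -/
theorem sum_factoredUpTo_union_le (f : ℕ →* ℝ) (h0 : ∀ n, 0 ≤ f n) (P Q : Finset ℕ)
    (hQ : ∀ p ∈ Q, p.Prime) (hQ1 : ∀ p ∈ Q, f p < 1) (y : ℕ) :
    ∑ n ∈ factoredUpTo (Q ∪ P) y, f n ≤
      (∏ p ∈ Q, (1 - f p)⁻¹) * ∑ n ∈ factoredUpTo P y, f n := by
  classical
  induction Q using Finset.induction_on with
  | empty => simp
  | insert p Q hpQ ih =>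
    have hp := hQ p (mem_insert_self _ _)
    have hp1 := hQ1 p (mem_insert_self _ _)
    have ih := ih (fun q hq => hQ q (mem_insert_of_mem hq)) fun q hq =>
      hQ1 q (mem_insert_of_mem hq)
    rw [prod_insert hpQ, mul_assoc]
    have key : ∑ n ∈ factoredUpTo (insert p Q ∪ P) y, f n ≤
        (∑ e ∈ range (y + 1), f p ^ e) * ∑ n ∈ factoredUpTo (Q ∪ P) y, f n := by
      rw [sum_mul_sum, ← sum_product']
      have hinj : Set.InjOn (fun n => (n.factorization p, ordCompl[p] n))
          (factoredUpTo (insert p Q ∪ P) y : Set ℕ) := by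
        intro n _ m _ hnm
        simp only [Prod.mk.injEq] at hnm
        rw [← Nat.ordProj_mul_ordCompl_eq_self n p, ← Nat.ordProj_mul_ordCompl_eq_self m p,
          hnm.2, hnm.1]
      have heq : ∀ n, f n = f p ^ (n.factorization p) * f (ordCompl[p] n) := fun n => by
        rw [← map_pow, ← map_mul, Nat.ordProj_mul_ordCompl_eq_self]
      calc ∑ n ∈ factoredUpTo (insert p Q ∪ P) y, f n
          = ∑ n ∈ factoredUpTo (insert p Q ∪ P) y,
            (fun x : ℕ × ℕ => f p ^ x.1 * f x.2) (n.factorization p, ordCompl[p] n) :=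
            sum_congr rfl fun n _ => heq n
        _ = ∑ x ∈ (factoredUpTo (insert p Q ∪ P) y).image
              (fun n => (n.factorization p, ordCompl[p] n)), f p ^ x.1 * f x.2 :=
            (sum_image (f := fun x : ℕ × ℕ => f p ^ x.1 * f x.2) hinj).symm
        _ ≤ _ := by
            refine sum_le_sum_of_subset_of_nonneg ?_ fun x _ _ =>
              mul_nonneg (pow_nonneg (h0 _) _) (h0 _)
            intro x hx
            obtain ⟨n, hn, rfl⟩ := mem_image.1 hx
            obtain ⟨⟨hn1, hny⟩, hnP⟩ := mem_factoredUpTo.1 hn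
            rw [mem_product, mem_range, mem_factoredUpTo]
            refine ⟨?_, ⟨Nat.ordCompl_pos p (by omega), (Nat.ordCompl_le n p).trans hny⟩, ?_⟩
            · have := (Nat.factorization_lt p (by omega : n ≠ 0))
              simp only; omega
            · intro q hq
              have h3 := hnP (Nat.primeFactors_mono (Nat.ordCompl_dvd n p) (by omega) hq)
              rw [insert_union, mem_insert] at h3
              refine h3.resolve_left fun hqp => ?_
              rw [hqp] at hq
              exact Nat.not_dvd_ordCompl hp (by omega : n ≠ 0) (Nat.dvd_of_mem_primeFactors hq)
    refine key.trans ?_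
    have hS : 0 ≤ ∑ n ∈ factoredUpTo (Q ∪ P) y, f n := sum_nonneg fun _ _ => h0 _
    have hinv : 0 ≤ (1 - f p)⁻¹ := inv_nonneg.2 (by linarith)
    exact mul_le_mul (geom_sum_le_inv (h0 p) hp1 _) ih hS hinv

/-- The completely multiplicative function `n ↦ s ^ Ω(n) / n`. -/
noncomputable def omegaHom (s : ℕ) : ℕ →* ℝ where
  toFun n := (s : ℝ) ^ cardFactors n / n
  map_one' := by simp
  map_mul' a b := by
    rcases eq_or_ne a 0 with rfl | ha
    · simp
    rcases eq_or_ne b 0 with rfl | hb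
    · simp
    rw [cardFactors_mul ha hb, pow_add]
    push_cast
    rw [mul_div_mul_comm]

theorem omegaHom_apply (s n : ℕ) : omegaHom s n = (s : ℝ) ^ cardFactors n / n := rfl

theorem omegaHom_nonneg (s n : ℕ) : 0 ≤ omegaHom s n := by
  rw [omegaHom_apply]; positivity

theorem omegaHom_prime (s : ℕ) {p : ℕ} (hp : p.Prime) : omegaHom s p = s / p := by
  rw [omegaHom_apply, cardFactors_apply_prime hp, pow_one]

/-- Each divisor of `p n` is a divisor `a` of `n` or of the form `p a`, so passing from `n` to `p n`
multiplies the divisor sum by at most `1 + s`. -/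
theorem sum_divisors_pow_cardFactors_le (s n : ℕ) :
    ∑ a ∈ n.divisors, (s : ℝ) ^ cardFactors a ≤ ((s + 1 : ℕ) : ℝ) ^ cardFactors n := by
  induction n using induction_on_primes with
  | zero => simp
  | one => simp
  | prime_mul p n hp ih =>
    rcases eq_or_ne n 0 with rfl | hn
    · simp
    have hsub : (p * n).divisors ⊆ n.divisors ∪ n.divisors.image (p * ·) := by
      intro d hd
      have hdvd := Nat.dvd_of_mem_divisors hd
      rw [mem_union, mem_image]
      by_cases hpd : p ∣ d
      · obtain ⟨e, rfl⟩ := hpd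
        exact Or.inr ⟨e, Nat.mem_divisors.2 ⟨Nat.dvd_of_mul_dvd_mul_left hp.pos hdvd, hn⟩, rfl⟩
      · exact Or.inl (Nat.mem_divisors.2
          ⟨(((Nat.Prime.coprime_iff_not_dvd hp).2 hpd).symm).dvd_of_dvd_mul_left hdvd, hn⟩)
    have himage : ∑ a ∈ n.divisors.image (p * ·), (s : ℝ) ^ cardFactors a =
        s * ∑ a ∈ n.divisors, (s : ℝ) ^ cardFactors a := by
      rw [sum_image fun a _ b _ h => Nat.eq_of_mul_eq_mul_left hp.pos h, mul_sum]
      refine sum_congr rfl fun a ha => ?_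
      rw [cardFactors_mul hp.ne_zero (Nat.pos_of_mem_divisors ha).ne',
        cardFactors_apply_prime hp, pow_add, pow_one]
    have hpos : ∀ A : Finset ℕ, 0 ≤ ∑ a ∈ A, (s : ℝ) ^ cardFactors a := fun A =>
      sum_nonneg fun _ _ => by positivity
    calc ∑ a ∈ (p * n).divisors, (s : ℝ) ^ cardFactors a
        ≤ ∑ a ∈ n.divisors ∪ n.divisors.image (p * ·), (s : ℝ) ^ cardFactors a :=
          sum_le_sum_of_subset_of_nonneg hsub fun _ _ _ => by positivity
      _ ≤ ∑ a ∈ n.divisors, (s : ℝ) ^ cardFactors a +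
            ∑ a ∈ n.divisors.image (p * ·), (s : ℝ) ^ cardFactors a := by
          rw [← sum_union_inter]
          exact le_add_of_nonneg_right (hpos _)
      _ = ((s + 1 : ℕ) : ℝ) * ∑ a ∈ n.divisors, (s : ℝ) ^ cardFactors a := by
          rw [himage]; push_cast; ring
      _ ≤ _ := by
          rw [cardFactors_mul hp.ne_zero hn, cardFactors_apply_prime hp, pow_add, pow_one]
          exact mul_le_mul_of_nonneg_left ih (by positivity)

/-- The sums `∑ s ^ Ω(n) / n` over larger and larger `s` dominate powers of the sum for `s = 1`. -/
theorem sum_omegaHom_mul_le (P : Finset ℕ) (s z y : ℕ) :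
    (∑ n ∈ factoredUpTo P z, omegaHom s n) * ∑ n ∈ factoredUpTo P y, omegaHom 1 n ≤
      ∑ n ∈ factoredUpTo P (z * y), omegaHom (s + 1) n := by
  classical
  rw [sum_mul_sum, ← sum_product']
  have hmaps : ∀ x ∈ factoredUpTo P z ×ˢ factoredUpTo P y,
      x.1 * x.2 ∈ factoredUpTo P (z * y) := by
    rintro ⟨a, b⟩ hx
    rw [mem_product] at hx
    obtain ⟨⟨ha1, haz⟩, haP⟩ := mem_factoredUpTo.1 hx.1
    obtain ⟨⟨hb1, hby⟩, hbP⟩ := mem_factoredUpTo.1 hx.2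
    simp only at *
    refine mem_factoredUpTo.2 ⟨⟨Nat.mul_pos ha1 hb1, Nat.mul_le_mul haz hby⟩, ?_⟩
    rw [Nat.primeFactors_mul (by omega) (by omega)]
    exact union_subset haP hbP
  rw [← sum_fiberwise_of_maps_to hmaps]
  refine sum_le_sum fun n hn => ?_
  have hn0 : n ≠ 0 := by have := (mem_factoredUpTo.1 hn).1.1; omega
  rw [omegaHom_apply]
  calc ∑ x ∈ (factoredUpTo P z ×ˢ factoredUpTo P y).filter (fun x => x.1 * x.2 = n),
        omegaHom s x.1 * omegaHom 1 x.2
      = ∑ x ∈ (factoredUpTo P z ×ˢ factoredUpTo P y).filter (fun x => x.1 * x.2 = n),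
        (fun a : ℕ => (s : ℝ) ^ cardFactors a / n) x.1 := by
        refine sum_congr rfl fun x hx => ?_
        rw [← (mem_filter.1 hx).2, omegaHom_apply, omegaHom_apply]
        push_cast
        rw [one_pow, ← mul_div_mul_comm, mul_one]
    _ = ∑ a ∈ ((factoredUpTo P z ×ˢ factoredUpTo P y).filter
          (fun x => x.1 * x.2 = n)).image Prod.fst, (s : ℝ) ^ cardFactors a / n := by
        refine (sum_image (f := fun a : ℕ => (s : ℝ) ^ cardFactors a / n) ?_).symm
        rintro ⟨a, b⟩ hx ⟨a', b'⟩ hx' h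
        have h1 := (mem_filter.1 hx).2
        have h2 := (mem_filter.1 hx').2
        simp only at h h1 h2
        subst h
        have ha : 0 < a := Nat.pos_of_ne_zero fun h => hn0 (by rw [← h1, h, zero_mul])
        rw [Nat.eq_of_mul_eq_mul_left ha (h1.trans h2.symm)]
    _ ≤ ∑ a ∈ n.divisors, (s : ℝ) ^ cardFactors a / n := by
        refine sum_le_sum_of_subset_of_nonneg ?_ fun _ _ _ => by positivity
        intro a ha
        obtain ⟨x, hx, rfl⟩ := mem_image.1 ha
        exact Nat.mem_divisors.2 ⟨⟨x.2, (mem_filter.1 hx).2.symm⟩, hn0⟩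
    _ ≤ _ := by
        rw [← sum_div]
        gcongr
        exact sum_divisors_pow_cardFactors_le s n

theorem pow_sum_omegaHom_one_le (P : Finset ℕ) (s y : ℕ) :
    (∑ n ∈ factoredUpTo P y, omegaHom 1 n) ^ s ≤
      ∑ n ∈ factoredUpTo P (y ^ s), omegaHom s n := by
  induction s with
  | zero =>
    have : factoredUpTo P (y ^ 0) = {1} := by
      ext n; rw [mem_factoredUpTo, mem_singleton, pow_zero]
      constructor
      · rintro ⟨h, -⟩; omega
      · rintro rfl; simp
    rw [this]; simp
  | succ s ih =>
    rw [pow_succ, pow_succ]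
    refine le_trans ?_ (sum_omegaHom_mul_le P s (y ^ s) y)
    exact mul_le_mul_of_nonneg_right ih (sum_nonneg fun _ _ => omegaHom_nonneg _ _)

/-- Grouping the integers `n` by their radical `d`: the sum over one group is at most
`∏ p ∣ d, ∑ e ≥ 1, (s / p) ^ e = sieveWeight s d`. -/
theorem sum_omegaHom_le_sum_sieveWeight {P : Finset ℕ} {s : ℕ} (hP : ∀ p ∈ P, s < p) (z : ℕ) :
    ∑ n ∈ factoredUpTo P z, omegaHom s n ≤ ∑ d ∈ sieveSupport P z, sieveWeight s d := by
  classical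
  have hmaps : ∀ n ∈ factoredUpTo P z, ∏ p ∈ n.primeFactors, p ∈ sieveSupport P z := by
    intro n hn
    obtain ⟨⟨hn1, hnz⟩, hnP⟩ := mem_factoredUpTo.1 hn
    rw [sieveSupport, mem_filter, mem_Icc]
    have hprime : ∀ p ∈ n.primeFactors, p.Prime := fun p hp => Nat.prime_of_mem_primeFactors hp
    refine ⟨⟨Finset.prod_pos fun p hp => (hprime p hp).pos,
      (Nat.le_of_dvd hn1 (Nat.prod_primeFactors_dvd n)).trans hnz⟩, ?_, ?_⟩
    · refine Finset.squarefree_prod_of_pairwise_isCoprime ?_ fun p hp => (hprime p hp).squarefree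
      intro p hp q hq hpq
      exact Nat.coprime_iff_isRelPrime.1 ((Nat.coprime_primes (hprime p hp) (hprime q hq)).2 hpq)
    · rw [Nat.primeFactors_prod hprime]
      exact hnP
  rw [← sum_fiberwise_of_maps_to hmaps]
  refine sum_le_sum fun d hd => ?_
  obtain ⟨⟨hd1, hdz⟩, hdsq, hdP⟩ : (1 ≤ d ∧ d ≤ z) ∧ Squarefree d ∧ d.primeFactors ⊆ P := by
    simpa [sieveSupport] using hd
  have hdiv : ∀ n ∈ (factoredUpTo P z).filter (fun n => ∏ p ∈ n.primeFactors, p = d),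
      d * (n / d) = n := fun n hn => by
    rw [← (mem_filter.1 hn).2]; exact Nat.mul_div_cancel' (Nat.prod_primeFactors_dvd n)
  have hlt : ∀ p ∈ d.primeFactors, omegaHom s p < 1 := fun p hp => by
    have hpp := Nat.prime_of_mem_primeFactors hp
    rw [omegaHom_prime s hpp, div_lt_one (by exact_mod_cast hpp.pos)]
    exact_mod_cast hP p (hdP hp)
  calc ∑ n ∈ (factoredUpTo P z).filter (fun n => ∏ p ∈ n.primeFactors, p = d), omegaHom s n
      = ∑ n ∈ (factoredUpTo P z).filter (fun n => ∏ p ∈ n.primeFactors, p = d),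
        (fun m => omegaHom s d * omegaHom s m) (n / d) := by
        refine sum_congr rfl fun n hn => ?_
        simp only
        rw [← map_mul, hdiv n hn]
    _ = ∑ m ∈ ((factoredUpTo P z).filter (fun n => ∏ p ∈ n.primeFactors, p = d)).image (· / d),
        omegaHom s d * omegaHom s m := by
        refine (sum_image (f := fun m => omegaHom s d * omegaHom s m) ?_).symm
        intro n hn m hm h
        rw [← hdiv n hn, ← hdiv m hm]
        simp only at h
        rw [h]
    _ ≤ ∑ m ∈ factoredUpTo (d.primeFactors ∪ ∅) z, omegaHom s d * omegaHom s m := by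
        refine sum_le_sum_of_subset_of_nonneg ?_ fun _ _ _ =>
          mul_nonneg (omegaHom_nonneg _ _) (omegaHom_nonneg _ _)
        intro m hm
        obtain ⟨n, hn, rfl⟩ := mem_image.1 hm
        obtain ⟨⟨hn1, hnz⟩, hnP⟩ := mem_factoredUpTo.1 (mem_filter.1 hn).1
        have h1 := hdiv n hn
        refine mem_factoredUpTo.2 ⟨⟨?_, (Nat.div_le_self _ _).trans hnz⟩, ?_⟩
        · rcases Nat.eq_zero_or_pos (n / d) with h | h
          · rw [h] at h1; omega
          · exact h
        · rw [union_empty]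
          intro p hp
          have hpn : p ∈ n.primeFactors :=
            Nat.primeFactors_mono (Dvd.intro_left d h1) (by omega) hp
          rw [← (mem_filter.1 hn).2, Nat.primeFactors_prod
            fun p hp => Nat.prime_of_mem_primeFactors hp]
          exact hpn
    _ ≤ omegaHom s d * ∏ p ∈ d.primeFactors, (1 - omegaHom s p)⁻¹ := by
        rw [← mul_sum]
        refine mul_le_mul_of_nonneg_left ?_ (omegaHom_nonneg _ _)
        refine (sum_factoredUpTo_union_le _ (omegaHom_nonneg s) ∅ d.primeFactors
          (fun p hp => Nat.prime_of_mem_primeFactors hp) hlt z).trans ?_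
        have : factoredUpTo ∅ z = {1} := by
          ext n
          rw [mem_factoredUpTo, mem_singleton, subset_empty, Nat.primeFactors_eq_empty]
          constructor
          · rintro ⟨h, h' | h'⟩ <;> omega
          · rintro rfl; omega
        rw [this]; simp
    _ = sieveWeight s d := by
        conv_lhs => rw [← Nat.prod_primeFactors_of_squarefree hdsq]
        rw [map_prod, Nat.primeFactors_prod fun p hp => Nat.prime_of_mem_primeFactors hp,
          ← prod_mul_distrib]
        refine prod_congr rfl fun p hp => ?_
        have hpp := Nat.prime_of_mem_primeFactors hp
        rw [omegaHom_prime s hpp]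
        have h1 : (0 : ℝ) < p := by exact_mod_cast hpp.pos
        have h2 : (s : ℝ) < p := by exact_mod_cast hP p (hdP hp)
        have h3 : (p : ℝ) - s ≠ 0 := by linarith
        field_simp

open Classical in
/-- The logarithm is bounded by the sum of `1 / n` over the integers composed of the primes of
`P`, times the Euler factors of the primes missing from `P`. -/
theorem log_le_prod_mul_sum_omegaHom (P : Finset ℕ) (y : ℕ) :
    Real.log (y + 1) ≤ (∏ p ∈ (range (y + 1)).filter (fun p => p.Prime ∧ p ∉ P),
      (1 - (p : ℝ)⁻¹)⁻¹) * ∑ n ∈ factoredUpTo P y, omegaHom 1 n := by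
  set Q := (range (y + 1)).filter (fun p => p.Prime ∧ p ∉ P) with hQ
  have hQp : ∀ p ∈ Q, p.Prime := fun p hp => (mem_filter.1 hp).2.1
  have hinv : ∀ p ∈ Q, omegaHom 1 p = (p : ℝ)⁻¹ := fun p hp => by
    rw [omegaHom_prime 1 (hQp p hp)]; simp
  have h1 := sum_factoredUpTo_union_le (omegaHom 1) (omegaHom_nonneg 1) P Q hQp (fun p hp => by
    rw [hinv p hp]
    exact inv_lt_one_of_one_lt₀ (by exact_mod_cast (hQp p hp).one_lt)) y
  rw [prod_congr rfl fun p hp => by rw [hinv p hp]] at h1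
  refine le_trans ?_ h1
  have h2 := log_add_one_le_harmonic y
  rw [harmonic_eq_sum_Icc] at h2
  push_cast at h2
  refine h2.trans ?_
  have : factoredUpTo (Q ∪ P) y = Icc 1 y := by
    refine filter_true_of_mem fun n hn p hp => ?_
    rw [mem_union]
    by_cases hpP : p ∈ P
    · exact Or.inr hpP
    · refine Or.inl (mem_filter.2 ⟨mem_range.2 ?_, Nat.prime_of_mem_primeFactors hp, hpP⟩)
      have := Nat.le_of_mem_primeFactors hp
      have := (mem_Icc.1 hn).2
      omega
  rw [this]
  refine sum_le_sum fun n _ => ?_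
  rw [omegaHom_apply]; simp

open Classical in
/-- The main term of the sieve of dimension `s` and level `y ^ s` is at least of order
`(log y) ^ s`, up to the Euler factors of the primes that are not sieved. -/
theorem log_pow_le_prod_mul_sum_sieveWeight {P : Finset ℕ} {s : ℕ} (hP : ∀ p ∈ P, s < p)
    (y : ℕ) :
    Real.log (y + 1) ^ s ≤ (∏ p ∈ (range (y + 1)).filter (fun p => p.Prime ∧ p ∉ P),
      (1 - (p : ℝ)⁻¹)⁻¹) ^ s * ∑ d ∈ sieveSupport P (y ^ s), sieveWeight s d := by
  have h1 := log_le_prod_mul_sum_omegaHom P y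
  have h2 : 0 ≤ ∏ p ∈ (range (y + 1)).filter (fun p => p.Prime ∧ p ∉ P),
      (1 - (p : ℝ)⁻¹)⁻¹ := by
    refine prod_nonneg fun p hp => inv_nonneg.2 (sub_nonneg.2 (inv_le_one_of_one_le₀ ?_))
    exact_mod_cast (mem_filter.1 hp).2.1.one_lt.le
  calc Real.log (y + 1) ^ s ≤ _ := pow_le_pow_left₀
        (Real.log_nonneg (by linarith [(Nat.cast_nonneg y : (0 : ℝ) ≤ y)])) h1 s
    _ = _ := mul_pow _ _ _
    _ ≤ _ := mul_le_mul_of_nonneg_left ((pow_sum_omegaHom_one_le P s y).trans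
        (sum_omegaHom_le_sum_sieveWeight hP _)) (pow_nonneg h2 _)

end MainTerm

/-! ### Sums of products of shifted von Mangoldt functions -/

section ShiftedPrimes

open Finset

/-- The Euler product `∏ p ∣ D, (1 - 1 / p)⁻¹ = |D| / φ(|D|)`. -/
noncomputable def eulerFactor (D : ℤ) : ℝ := ∏ p ∈ D.natAbs.primeFactors, (1 - (p : ℝ)⁻¹)⁻¹

theorem one_le_inv_one_sub_inv {p : ℕ} (hp : p.Prime) : 1 ≤ (1 - (p : ℝ)⁻¹)⁻¹ := by
  have h1 : (1 : ℝ) < p := by exact_mod_cast hp.one_lt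
  have h2 : (p : ℝ)⁻¹ < 1 := inv_lt_one_of_one_lt₀ h1
  have h3 : 0 < (p : ℝ)⁻¹ := by positivity
  rw [one_le_inv₀ (by linarith)]
  linarith

theorem one_le_eulerFactor (D : ℤ) : 1 ≤ eulerFactor D :=
  one_le_prod fun _ hp => one_le_inv_one_sub_inv (Nat.prime_of_mem_primeFactors hp)

theorem prod_union_le_mul {α : Type*} [DecidableEq α] {g : α → ℝ} {A B : Finset α}
    (hA : ∀ a ∈ A, 1 ≤ g a) (hB : ∀ a ∈ B, 1 ≤ g a) :
    ∏ a ∈ A ∪ B, g a ≤ (∏ a ∈ A, g a) * ∏ a ∈ B, g a := by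
  rw [← prod_union_inter]
  refine le_mul_of_one_le_right (prod_nonneg fun a ha => ?_)
    (one_le_prod fun a ha => hA a (mem_inter.1 ha).1)
  rcases mem_union.1 ha with h | h
  · linarith [hA a h]
  · linarith [hB a h]

theorem prod_biUnion_le_prod {α β : Type*} [DecidableEq α] [DecidableEq β] {g : α → ℝ}
    (O : Finset β) (f : β → Finset α) (hf : ∀ x ∈ O, ∀ a ∈ f x, 1 ≤ g a) :
    ∏ a ∈ O.biUnion f, g a ≤ ∏ x ∈ O, ∏ a ∈ f x, g a := by
  induction O using Finset.induction_on with
  | empty => simp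
  | insert x O hx ih =>
    rw [biUnion_insert, prod_insert hx]
    have ih := ih fun x hx => hf x (mem_insert_of_mem hx)
    have h1 := hf x (mem_insert_self _ _)
    refine (prod_union_le_mul h1 ?_).trans
      (mul_le_mul_of_nonneg_left ih (prod_nonneg fun a ha => by linarith [h1 a ha]))
    intro a ha
    obtain ⟨w, hw, haw⟩ := mem_biUnion.1 ha
    exact hf w (mem_insert_of_mem hw) a haw

/-- `n` is hit by `p` if `p` divides one of the numbers `n + b`, for `b ∈ B`. -/
def shiftHit (B : Finset ℤ) (p n : ℕ) : Prop := ∃ b ∈ B, (p : ℤ) ∣ n + b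

open Classical in
/-- The primes `2 * |B| ≤ p ≤ z` modulo which the elements of `B` are distinct. -/
noncomputable def shiftPrimes (B : Finset ℤ) (z : ℕ) : Finset ℕ :=
  (range (z + 1)).filter fun p => p.Prime ∧ 2 * B.card ≤ p ∧
    ∀ x ∈ B.offDiag, ¬ (p : ℤ) ∣ x.1 - x.2

theorem isSieve_shiftHit {B : Finset ℤ} (hB : 1 ≤ B.card) (z : ℕ) :
    IsSieve (shiftPrimes B z) B.card (shiftHit B) where
  one_le := hB
  prime p hp := (mem_filter.1 hp).2.1
  two_mul_le p hp := (mem_filter.1 hp).2.2.1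
  periodic p hp n := by
    refine exists_congr fun b => and_congr_right fun _ => ?_
    push_cast
    rw [show (n : ℤ) + p + b = n + b + p by ring]
    exact dvd_add_self_right
  card p hp := by
    classical
    obtain ⟨-, hpp, -, hd⟩ := mem_filter.1 hp
    have hp0 : (0 : ℤ) < p := by exact_mod_cast hpp.pos
    have hi : ∀ b : ℤ, (((-b) % p).toNat : ℤ) = (-b) % p := fun b =>
      Int.toNat_of_nonneg (Int.emod_nonneg _ hp0.ne')
    have hdv : ∀ b : ℤ, (p : ℤ) ∣ (-b) % p + b := fun b => by
      have := Int.dvd_sub_self_of_emod_eq (a := -b) (b := p) rfl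
      have h2 := (dvd_neg (α := ℤ)).2 this
      simpa [neg_sub, sub_neg_eq_add] using this
    symm
    refine card_bij (fun b _ => ((-b) % p).toNat) ?_ ?_ ?_
    · intro b hb
      rw [mem_filter, mem_range]
      refine ⟨?_, b, hb, ?_⟩
      · have := Int.emod_lt_of_pos (-b) hp0
        rw [← hi] at this
        exact_mod_cast this
      · rw [hi]; exact hdv b
    · intro b hb b' hb' h
      by_contra hne
      refine hd (b, b') (mem_offDiag.2 ⟨hb, hb', hne⟩) ?_
      have h1 := hdv b
      have h2 := hdv b'
      rw [← hi] at h1 h2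
      rw [h] at h1
      have := dvd_sub h1 h2
      simpa using this
    · intro n hn
      obtain ⟨hnp, b, hb, hnb⟩ := mem_filter.1 hn
      rw [mem_range] at hnp
      refine ⟨b, hb, ?_⟩
      have h1 : (n : ℤ) % p = (-b) % p := by
        exact Int.ModEq.symm ((Int.modEq_iff_dvd).2 (by simpa using hnb))
      rw [← h1, Int.emod_eq_of_lt (by positivity) (by exact_mod_cast hnp)]
      simp

open Classical in
/-- The Euler factors of the primes that `shiftPrimes` leaves out. -/
theorem prod_not_mem_shiftPrimes_le (B : Finset ℤ) {y z : ℕ} (hyz : y ≤ z) :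
    ∏ p ∈ (range (y + 1)).filter (fun p => p.Prime ∧ p ∉ shiftPrimes B z), (1 - (p : ℝ)⁻¹)⁻¹ ≤
      (∏ p ∈ (range (2 * B.card)).filter Nat.Prime, (1 - (p : ℝ)⁻¹)⁻¹) *
        ∏ x ∈ B.offDiag, eulerFactor (x.1 - x.2) := by
  set A := (range (2 * B.card)).filter Nat.Prime
  set f : ℤ × ℤ → Finset ℕ := fun x => (x.1 - x.2).natAbs.primeFactors with hf
  have hA : ∀ p ∈ A, 1 ≤ (1 - (p : ℝ)⁻¹)⁻¹ := fun p hp =>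
    one_le_inv_one_sub_inv (mem_filter.1 hp).2
  have hfx : ∀ x ∈ B.offDiag, ∀ p ∈ f x, 1 ≤ (1 - (p : ℝ)⁻¹)⁻¹ := fun x _ p hp =>
    one_le_inv_one_sub_inv (Nat.prime_of_mem_primeFactors hp)
  have hU : ∀ p ∈ B.offDiag.biUnion f, 1 ≤ (1 - (p : ℝ)⁻¹)⁻¹ := fun p hp => by
    obtain ⟨x, hx, hpx⟩ := mem_biUnion.1 hp
    exact hfx x hx p hpx
  have hsub : (range (y + 1)).filter (fun p => p.Prime ∧ p ∉ shiftPrimes B z) ⊆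
      A ∪ B.offDiag.biUnion f := by
    intro p hp
    obtain ⟨hpy, hpp, hpn⟩ := mem_filter.1 hp
    rw [mem_range] at hpy
    rw [mem_union]
    by_cases h2 : p < 2 * B.card
    · exact Or.inl (mem_filter.2 ⟨mem_range.2 h2, hpp⟩)
    · right
      rw [shiftPrimes, mem_filter, mem_range] at hpn
      have : ¬ ∀ x ∈ B.offDiag, ¬ (p : ℤ) ∣ x.1 - x.2 := fun h =>
        hpn ⟨by omega, hpp, by omega, h⟩
      push Not at this
      obtain ⟨x, hx, hdvd⟩ := this
      refine mem_biUnion.2 ⟨x, hx, Nat.mem_primeFactors.2 ⟨hpp, Int.natCast_dvd.1 hdvd, ?_⟩⟩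
      have := (mem_offDiag.1 hx).2.2
      omega
  calc _ ≤ ∏ p ∈ A ∪ B.offDiag.biUnion f, (1 - (p : ℝ)⁻¹)⁻¹ := by
        rw [← sdiff_union_of_subset hsub, prod_union sdiff_disjoint]
        refine le_mul_of_one_le_left (prod_nonneg fun p hp => ?_)
          (one_le_prod fun p hp => ?_)
        · linarith [one_le_inv_one_sub_inv (mem_filter.1 hp).2.1]
        · rcases mem_union.1 (mem_sdiff.1 hp).1 with h | h
          · exact hA p h
          · exact hU p h
    _ ≤ _ := (prod_union_le_mul hA hU).trans (mul_le_mul_of_nonneg_left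
        (prod_biUnion_le_prod _ _ hfx) (prod_nonneg fun p hp => by linarith [hA p hp]))

open Classical in
theorem card_not_shiftHit_mul_log_pow_le {B : Finset ℤ} (hB : 1 ≤ B.card) {y : ℕ} (hy : 1 ≤ y)
    (N : ℕ) :
    (((range N).filter fun n => ∀ p ∈ shiftPrimes B (y ^ B.card), ¬ shiftHit B p n).card : ℝ) *
      Real.log (y + 1) ^ B.card ≤
      ((∏ p ∈ (range (2 * B.card)).filter Nat.Prime, (1 - (p : ℝ)⁻¹)⁻¹) *
        ∏ x ∈ B.offDiag, eulerFactor (x.1 - x.2)) ^ B.card *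
        (N + (y : ℝ) ^ B.card + ((y : ℝ) ^ B.card) ^ 4) := by
  set s := B.card with hs
  set P := shiftPrimes B (y ^ s) with hP
  have hS := isSieve_shiftHit hB (y ^ s)
  rw [← hs, ← hP] at hS
  set S := ∑ d ∈ sieveSupport P (y ^ s), sieveWeight s d with hSdef
  set c := (((range N).filter fun n => ∀ p ∈ P, ¬ shiftHit B p n).card : ℝ) with hc
  have h1 : c * S ^ 2 ≤ (N + (y ^ s : ℕ)) * S + ((y ^ s : ℕ) : ℝ) ^ 4 :=
    hS.card_unsifted_mul_sq_le N (y ^ s)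
  have hS1 : 1 ≤ S := by
    have h1mem : 1 ∈ sieveSupport P (y ^ s) := by
      simp only [sieveSupport, mem_filter, mem_Icc]
      exact ⟨⟨le_rfl, Nat.one_le_pow _ _ hy⟩, squarefree_one, by simp⟩
    have hw : ∀ d ∈ sieveSupport P (y ^ s), 0 ≤ sieveWeight s d := fun d hd =>
      prod_nonneg fun p hp => (hS.density_pos ((mem_filter.1 hd).2.2 hp)).le
    refine le_trans ?_ (single_le_sum hw h1mem)
    simp [sieveWeight]
  have hsp : ∀ p ∈ P, s < p := fun p hp => by
    have := hS.two_mul_le p hp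
    omega
  have h2 := log_pow_le_prod_mul_sum_sieveWeight hsp y
  have h3 := prod_not_mem_shiftPrimes_le B (Nat.le_self_pow (by omega : s ≠ 0) y)
  rw [← hP, ← hs] at h3
  set R := ∏ p ∈ (range (y + 1)).filter (fun p => p.Prime ∧ p ∉ P), (1 - (p : ℝ)⁻¹)⁻¹ with hR
  set R' := (∏ p ∈ (range (2 * s)).filter Nat.Prime, (1 - (p : ℝ)⁻¹)⁻¹) *
        ∏ x ∈ B.offDiag, eulerFactor (x.1 - x.2) with hR'
  have hR0 : 0 ≤ R := prod_nonneg fun p hp => by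
    linarith [one_le_inv_one_sub_inv (mem_filter.1 hp).2.1]
  have hc0 : 0 ≤ c := Nat.cast_nonneg _
  have h4 : c * S ≤ N + (y : ℝ) ^ s + ((y : ℝ) ^ s) ^ 4 := by
    push_cast at h1
    have h5 : (c * S) * S ≤ (N + (y : ℝ) ^ s + ((y : ℝ) ^ s) ^ 4) * S := by
      have : ((y : ℝ) ^ s) ^ 4 ≤ ((y : ℝ) ^ s) ^ 4 * S :=
        le_mul_of_one_le_right (by positivity) hS1
      nlinarith
    exact le_of_mul_le_mul_right h5 (by linarith)
  calc c * Real.log (y + 1) ^ s ≤ c * (R ^ s * S) := mul_le_mul_of_nonneg_left h2 hc0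
    _ = R ^ s * (c * S) := by ring
    _ ≤ R' ^ s * (N + (y : ℝ) ^ s + ((y : ℝ) ^ s) ^ 4) := by
        have hR'0 : 0 ≤ R' := hR0.trans h3
        gcongr

theorem vonMangoldtInt_nonneg (n : ℤ) : 0 ≤ vonMangoldtInt n :=
  ArithmeticFunction.vonMangoldt_nonneg

theorem vonMangoldtInt_le_log {n : ℤ} {x : ℝ} (hx : 1 ≤ x) (hn : (n : ℝ) ≤ x) :
    vonMangoldtInt n ≤ Real.log x := by
  rcases le_or_gt n 0 with h | h
  · rw [vonMangoldtInt, Int.toNat_of_nonpos h]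
    simpa using Real.log_nonneg hx
  · refine ArithmeticFunction.vonMangoldt_le_log.trans (Real.log_le_log ?_ ?_)
    · have : 0 < n.toNat := by omega
      exact_mod_cast this
    · refine le_trans (le_of_eq ?_) hn
      have : ((n.toNat : ℤ) : ℝ) = n := by rw [Int.toNat_of_nonneg h.le]
      exact_mod_cast this

theorem exists_eq_pow_of_vonMangoldtInt_ne_zero {n : ℤ} (h : vonMangoldtInt n ≠ 0) :
    ∃ p k : ℕ, p.Prime ∧ 0 < k ∧ n = (p : ℤ) ^ k := by
  rw [vonMangoldtInt, ArithmeticFunction.vonMangoldt_ne_zero_iff, isPrimePow_nat_iff] at h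
  obtain ⟨p, k, hp, hk, h⟩ := h
  refine ⟨p, k, hp, hk, ?_⟩
  have h1 : 0 < n.toNat := h ▸ pow_pos hp.pos k
  have h2 : (n.toNat : ℤ) = n := Int.toNat_of_nonneg (by omega)
  rw [← h2, ← h]; push_cast; rfl

open Classical in
/-- If all the numbers `n + b` are prime powers and `n` is nevertheless sifted out, then one of
them is a power of a prime below the sieving limit. -/
theorem card_shiftHit_le (B : Finset ℤ) (N z E : ℕ)
    (hE : ∀ n < N, ∀ b ∈ B, (n : ℤ) + b < 2 ^ E) :
    ((range N).filter fun n : ℕ => (∀ b ∈ B, vonMangoldtInt (n + b) ≠ 0) ∧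
      ∃ p ∈ shiftPrimes B z, shiftHit B p n).card ≤ B.card * (z + 1) * E := by
  have hsub : ((range N).filter fun n : ℕ => (∀ b ∈ B, vonMangoldtInt (n + b) ≠ 0) ∧
      ∃ p ∈ shiftPrimes B z, shiftHit B p n) ⊆
      (B ×ˢ range (z + 1) ×ˢ range E).image
        (fun x => ((x.2.1 : ℤ) ^ x.2.2 - x.1).toNat) := by
    intro n hn
    obtain ⟨hnN, hne, p, hp, b, hb, hpb⟩ := mem_filter.1 hn
    obtain ⟨hpz, hpp, -⟩ := mem_filter.1 hp
    obtain ⟨q, k, hq, hk, hqk⟩ := exists_eq_pow_of_vonMangoldtInt_ne_zero (hne b hb)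
    have hpq : p = q := by
      rw [hqk] at hpb
      have : p ∣ q ^ k := by exact_mod_cast hpb
      exact (Nat.prime_dvd_prime_iff_eq hpp hq).1 (hpp.dvd_of_dvd_pow this)
    subst hpq
    refine mem_image.2 ⟨(b, p, k), ?_, ?_⟩
    · simp only [mem_product]
      refine ⟨hb, hpz, mem_range.2 ?_⟩
      have h1 := hE n (mem_range.1 hnN) b hb
      rw [hqk] at h1
      have h2 : p ^ k < 2 ^ E := by exact_mod_cast h1
      exact (Nat.pow_lt_pow_iff_right (by norm_num)).1
        ((Nat.pow_le_pow_left hpp.two_le k).trans_lt h2)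
    · simp only [← hqk]; simp
  refine (card_le_card hsub).trans (card_image_le.trans ?_)
  simp [mul_assoc]

/-- Only prime powers contribute to the correlation sum: the unsifted `n` are counted by the
sieve, the sifted ones by `card_shiftHit_le`. -/
theorem sum_prod_vonMangoldtInt_le {B : Finset ℤ} (hB : 1 ≤ B.card) {y : ℕ} (hy : 1 ≤ y)
    (N E : ℕ) (hE : ∀ n < N, ∀ b ∈ B, (n : ℤ) + b < 2 ^ E) {M : ℝ}
    (hM : ∀ n < N, ∀ b ∈ B, vonMangoldtInt ((n : ℤ) + b) ≤ M) (hM0 : 0 ≤ M) :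
    (∑ n ∈ range N, ∏ b ∈ B, vonMangoldtInt ((n : ℤ) + b)) * Real.log (y + 1) ^ B.card ≤
      M ^ B.card * (((∏ p ∈ (range (2 * B.card)).filter Nat.Prime, (1 - (p : ℝ)⁻¹)⁻¹) *
        ∏ x ∈ B.offDiag, eulerFactor (x.1 - x.2)) ^ B.card *
        (N + (y : ℝ) ^ B.card + ((y : ℝ) ^ B.card) ^ 4) +
        B.card * ((y : ℝ) ^ B.card + 1) * E * Real.log (y + 1) ^ B.card) := by
  classical
  set s := B.card with hs
  set P := shiftPrimes B (y ^ s) with hP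
  set U := (range N).filter fun n => ∀ p ∈ P, ¬ shiftHit B p n with hU
  set V := (range N).filter fun n : ℕ => (∀ b ∈ B, vonMangoldtInt (n + b) ≠ 0) ∧
      ∃ p ∈ P, shiftHit B p n with hV
  have hnn : ∀ n : ℕ, 0 ≤ ∏ b ∈ B, vonMangoldtInt ((n : ℤ) + b) := fun n =>
    prod_nonneg fun b _ => vonMangoldtInt_nonneg _
  have h1 : ∑ n ∈ range N, ∏ b ∈ B, vonMangoldtInt ((n : ℤ) + b) ≤
      ((U.card : ℝ) + V.card) * M ^ s := by
    calc ∑ n ∈ range N, ∏ b ∈ B, vonMangoldtInt ((n : ℤ) + b)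
        = ∑ n ∈ U ∪ V, ∏ b ∈ B, vonMangoldtInt ((n : ℤ) + b) := by
          symm
          refine sum_subset (union_subset (filter_subset _ _) (filter_subset _ _)) ?_
          intro n hn hnot
          by_contra hne
          rw [← ne_eq, prod_ne_zero_iff] at hne
          rw [mem_union, not_or] at hnot
          by_cases hh : ∀ p ∈ P, ¬ shiftHit B p n
          · exact hnot.1 (mem_filter.2 ⟨hn, hh⟩)
          · push Not at hh
            exact hnot.2 (mem_filter.2 ⟨hn, hne, hh⟩)
      _ ≤ (U ∪ V).card • M ^ s := by
          refine sum_le_card_nsmul _ _ _ fun n hn => ?_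
          have hnN : n < N := by
            rcases mem_union.1 hn with h | h <;> exact mem_range.1 (mem_filter.1 h).1
          rw [hs, ← prod_const]
          exact prod_le_prod (fun b _ => vonMangoldtInt_nonneg _) fun b hb => hM n hnN b hb
      _ ≤ _ := by
          rw [nsmul_eq_mul]
          refine mul_le_mul_of_nonneg_right ?_ (pow_nonneg hM0 _)
          exact_mod_cast card_union_le _ _
  have hlog : 0 ≤ Real.log ((y : ℝ) + 1) :=
    Real.log_nonneg (by linarith [(Nat.cast_nonneg y : (0 : ℝ) ≤ y)])
  have hUc := card_not_shiftHit_mul_log_pow_le hB hy N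
  have hVc : (V.card : ℝ) ≤ s * ((y : ℝ) ^ s + 1) * E := by
    exact_mod_cast card_shiftHit_le B N (y ^ s) E hE
  calc _ ≤ ((U.card : ℝ) + V.card) * M ^ s * Real.log (y + 1) ^ s :=
        mul_le_mul_of_nonneg_right h1 (pow_nonneg hlog _)
    _ = M ^ s * (U.card * Real.log (y + 1) ^ s + V.card * Real.log (y + 1) ^ s) := by ring
    _ ≤ _ := by
        refine mul_le_mul_of_nonneg_left (add_le_add hUc ?_) (pow_nonneg hM0 _)
        exact mul_le_mul_of_nonneg_right hVc (pow_nonneg hlog _)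

end ShiftedPrimes

/-! ### Correlations of the von Mangoldt function -/

section Correlations

open Finset

theorem exists_log_mul_le (c : ℝ) (hc : 1 ≤ c) :
    ∃ C : ℝ, 1 ≤ C ∧ ∀ X : ℝ, 2 ≤ X → Real.log (c * X) ≤ C * Real.log X := by
  have h2 : 0 < Real.log 2 := Real.log_pos (by norm_num)
  have hlc : 0 ≤ Real.log c := Real.log_nonneg hc
  refine ⟨Real.log c / Real.log 2 + 1, by linarith [div_nonneg hlc h2.le], fun X hX => ?_⟩
  have hX2 : Real.log 2 ≤ Real.log X := Real.log_le_log (by norm_num) hX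
  rw [Real.log_mul (by linarith) (by linarith), add_mul, one_mul]
  have : Real.log c = Real.log c / Real.log 2 * Real.log 2 := by field_simp
  have h3 : Real.log c / Real.log 2 * Real.log 2 ≤ Real.log c / Real.log 2 * Real.log X := by
    gcongr
  linarith

/-- Any fixed power of the logarithm is bounded by the square root. -/
theorem log_pow_le_sqrt {X : ℝ} (hX : 1 ≤ X) (r : ℕ) (hr : 1 ≤ r) :
    Real.log X ^ r ≤ (2 * r : ℝ) ^ r * √X := by
  have hr0 : (0 : ℝ) < r := by exact_mod_cast hr
  have h1 := Real.log_le_rpow_div (by linarith : 0 ≤ X) (by positivity : (0 : ℝ) < 1 / (2 * r))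
  have h2 : Real.log X ≤ 2 * r * X ^ ((1 : ℝ) / (2 * r)) := by
    refine h1.trans (le_of_eq ?_)
    field_simp
  calc Real.log X ^ r ≤ (2 * r * X ^ ((1 : ℝ) / (2 * r))) ^ r :=
        pow_le_pow_left₀ (Real.log_nonneg hX) h2 r
    _ = (2 * r : ℝ) ^ r * √X := by
        rw [mul_pow, ← Real.rpow_natCast (X ^ _), ← Real.rpow_mul (by linarith),
          Real.sqrt_eq_rpow]
        congr 2
        field_simp

/-- **Upper bound for prime tuples.** The correlation of `s` distinct shifts of the von Mangoldt
function up to `X` is `O(X)`, up to the Euler factors of the differences of the shifts. The sieve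
is used with `y = X ^ (1 / (4 s))`, that is, at level `z = y ^ s ≤ X ^ (1 / 4)`. -/
theorem exists_sum_prod_vonMangoldtInt_le (s : ℕ) (hs : 1 ≤ s) (c : ℝ) (hc : 1 ≤ c) :
    ∃ C : ℝ, 0 < C ∧ ∀ X : ℝ, 2 ≤ X → ∀ B : Finset ℤ, B.card = s → (∀ b ∈ B, (b : ℝ) ≤ c * X) →
      ∑ n ∈ range ⌈X⌉₊, ∏ b ∈ B, vonMangoldtInt ((n : ℤ) + b) ≤
        C * X * (∏ x ∈ B.offDiag, eulerFactor (x.1 - x.2)) ^ s := by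
  obtain ⟨c₁, hc₁, hlog⟩ := exists_log_mul_le (c + 1) (by linarith)
  set c₀ : ℝ := ∏ p ∈ (range (2 * s)).filter Nat.Prime, (1 - (p : ℝ)⁻¹)⁻¹ with hc₀
  have hc₀1 : 1 ≤ c₀ := one_le_prod fun p hp => one_le_inv_one_sub_inv (mem_filter.1 hp).2
  have hl2 : 0 < Real.log 2 := Real.log_pos (by norm_num)
  set c₂ : ℝ := (c₁ + 2) / Real.log 2 with hc₂
  have hc₂0 : 0 < c₂ := by positivity
  have hs0 : (0 : ℝ) < s := by exact_mod_cast hs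
  refine ⟨c₁ ^ s * (c₀ ^ s * 4 * (4 * s) ^ s) +
    c₁ ^ s * (s * 2 * c₂ * (2 * (s + 1 : ℕ)) ^ (s + 1)), by positivity, ?_⟩
  intro X hX B hB hbX
  set G := ∏ x ∈ B.offDiag, eulerFactor (x.1 - x.2) with hG
  have hG1 : 1 ≤ G := one_le_prod fun x _ => one_le_eulerFactor _
  have hX0 : 0 < X := by linarith
  set lg := Real.log X with hlg
  have hlg2 : Real.log 2 ≤ lg := Real.log_le_log (by norm_num) hX
  have hlg0 : 0 < lg := by linarith
  have hcX : ∀ n < ⌈X⌉₊, ∀ b ∈ B, (((n : ℤ) + b : ℤ) : ℝ) ≤ (c + 1) * X := by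
    intro n hn b hb
    have h1 := Nat.lt_ceil.1 hn
    have h2 := hbX b hb
    push_cast
    linarith
  set y := ⌊X ^ ((1 : ℝ) / (4 * s))⌋₊ with hy
  have hX1 : 1 ≤ X ^ ((1 : ℝ) / (4 * s)) := Real.one_le_rpow (by linarith) (by positivity)
  have hy1 : 1 ≤ y := Nat.le_floor (by simpa using hX1)
  have hyX : ((y : ℝ) ^ s) ^ 4 ≤ X := by
    have h1 : (y : ℝ) ≤ X ^ ((1 : ℝ) / (4 * s)) := Nat.floor_le (by positivity)
    calc ((y : ℝ) ^ s) ^ 4 ≤ ((X ^ ((1 : ℝ) / (4 * s))) ^ s) ^ 4 := by gcongr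
      _ = X := by
        rw [← pow_mul, ← Real.rpow_natCast, ← Real.rpow_mul hX0.le]
        conv_rhs => rw [← Real.rpow_one X]
        congr 1
        push_cast
        field_simp
  set ℓ := Real.log ((y : ℝ) + 1) with hℓ
  have hℓlg : lg / (4 * s) ≤ ℓ := by
    have h1 : X ^ ((1 : ℝ) / (4 * s)) ≤ (y : ℝ) + 1 := (Nat.lt_floor_add_one _).le
    have h2 := Real.log_le_log (by positivity) h1
    rw [Real.log_rpow hX0] at h2
    rw [hℓ]
    refine le_trans (le_of_eq ?_) h2
    ring
  have hℓ0 : 0 < ℓ := lt_of_lt_of_le (by positivity) hℓlg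
  set z : ℝ := (y : ℝ) ^ s with hz
  have hz1 : 1 ≤ z := one_le_pow₀ (by exact_mod_cast hy1)
  have hzX : z ≤ X := le_trans (le_self_pow₀ hz1 (by norm_num)) hyX
  have hzs : z ≤ √X := by
    apply Real.le_sqrt_of_sq_le
    exact le_trans (pow_le_pow_right₀ hz1 (by norm_num)) hyX
  set E := ⌈Real.logb 2 ((c + 1) * X)⌉₊ + 1 with hE
  have hcX1 : 1 ≤ (c + 1) * X := by nlinarith
  have hE2 : (c + 1) * X < 2 ^ E := by
    rw [← Real.rpow_natCast, ← Real.logb_lt_iff_lt_rpow (by norm_num) (by linarith), hE]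
    push_cast
    linarith [Nat.le_ceil (Real.logb 2 ((c + 1) * X))]
  have hEle : (E : ℝ) ≤ c₂ * lg := by
    have h1 := (Nat.ceil_lt_add_one (Real.logb_nonneg (b := 2) (by norm_num) hcX1)).le
    have h2 : Real.logb 2 ((c + 1) * X) ≤ c₁ * lg / Real.log 2 := by
      rw [Real.logb]; gcongr; exact hlog X hX
    have h3 : (2 : ℝ) ≤ 2 * lg / Real.log 2 := by
      rw [le_div_iff₀ hl2]; linarith
    rw [hE, hc₂]
    push_cast
    calc _ ≤ c₁ * lg / Real.log 2 + 2 * lg / Real.log 2 := by linarith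
      _ = _ := by ring
  have hEB : ∀ n < ⌈X⌉₊, ∀ b ∈ B, (n : ℤ) + b < 2 ^ E := by
    intro n hn b hb
    have := (hcX n hn b hb).trans_lt hE2
    exact_mod_cast this
  have hM : ∀ n < ⌈X⌉₊, ∀ b ∈ B, vonMangoldtInt ((n : ℤ) + b) ≤ c₁ * lg := fun n hn b hb =>
    (vonMangoldtInt_le_log hcX1 (hcX n hn b hb)).trans (hlog X hX)
  have key := sum_prod_vonMangoldtInt_le (hB ▸ hs : 1 ≤ B.card) hy1 ⌈X⌉₊ E hEB hM (by positivity)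
  rw [hB] at key
  set T := ∑ n ∈ range ⌈X⌉₊, ∏ b ∈ B, vonMangoldtInt ((n : ℤ) + b)
  have hN : (⌈X⌉₊ : ℝ) ≤ 2 * X := by linarith [Nat.ceil_lt_add_one hX0.le]
  have hmain : (c₀ * G) ^ s * (⌈X⌉₊ + z + z ^ 4) ≤
      c₀ ^ s * G ^ s * (4 * X) * (4 * s) ^ s / lg ^ s * ℓ ^ s := by
    have h1 : 1 ≤ (4 * s : ℝ) ^ s / lg ^ s * ℓ ^ s := by
      rw [← div_pow, ← mul_pow]
      apply one_le_pow₀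
      rw [div_mul_eq_mul_div, one_le_div hlg0]
      rw [div_le_iff₀ (by positivity)] at hℓlg
      linarith
    calc (c₀ * G) ^ s * (⌈X⌉₊ + z + z ^ 4) ≤ c₀ ^ s * G ^ s * (4 * X) := by
          rw [mul_pow]; gcongr; linarith
      _ ≤ c₀ ^ s * G ^ s * (4 * X) * ((4 * s : ℝ) ^ s / lg ^ s * ℓ ^ s) :=
          le_mul_of_one_le_right (by positivity) h1
      _ = _ := by ring
  have hT : T ≤ (c₁ * lg) ^ s * (c₀ ^ s * G ^ s * (4 * X) * (4 * s) ^ s / lg ^ s +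
      s * (z + 1) * E) := by
    refine le_of_mul_le_mul_right (key.trans ?_) (pow_pos hℓ0 s)
    rw [mul_assoc ((c₁ * lg) ^ s), add_mul]
    exact mul_le_mul_of_nonneg_left (add_le_add hmain le_rfl) (by positivity)
  have hlgs : lg ^ s * lg ≤ (2 * (s + 1 : ℕ) : ℝ) ^ (s + 1) * √X := by
    rw [← pow_succ]
    exact_mod_cast log_pow_le_sqrt (by linarith : 1 ≤ X) (s + 1) (by omega)
  calc T ≤ _ := hT
    _ ≤ (c₁ * lg) ^ s * (c₀ ^ s * G ^ s * (4 * X) * (4 * s) ^ s / lg ^ s +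
      s * (2 * √X) * (c₂ * lg)) := by
        gcongr
        linarith
    _ = c₁ ^ s * (c₀ ^ s * 4 * (4 * s) ^ s) * X * G ^ s +
        c₁ ^ s * (s * 2 * c₂) * √X * (lg ^ s * lg) := by
        rw [mul_pow]
        field_simp
    _ ≤ c₁ ^ s * (c₀ ^ s * 4 * (4 * s) ^ s) * X * G ^ s +
        c₁ ^ s * (s * 2 * c₂) * √X * ((2 * (s + 1 : ℕ) : ℝ) ^ (s + 1) * √X) := by
        gcongr
    _ = c₁ ^ s * (c₀ ^ s * 4 * (4 * s) ^ s) * X * G ^ s +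
        c₁ ^ s * (s * 2 * c₂ * (2 * (s + 1 : ℕ)) ^ (s + 1)) * X := by
        have : √X * √X = X := Real.mul_self_sqrt hX0.le
        linear_combination (c₁ ^ s * (s * 2 * c₂ * (2 * (s + 1 : ℕ) : ℝ) ^ (s + 1))) * this
    _ ≤ _ := by
        rw [add_mul, add_mul]
        exact add_le_add le_rfl (le_mul_of_one_le_right (by positivity) (one_le_pow₀ hG1))

/-! ### Mean values of the Euler factors -/

theorem prod_one_add_inv_sqrt_le {n : ℕ} (hn : n ≠ 0) :
    ∏ p ∈ n.primeFactors, (1 + (√(p : ℝ))⁻¹) ≤ ∑ d ∈ n.divisors, (√(d : ℝ))⁻¹ := by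
  classical
  have hpp : ∀ I ∈ n.primeFactors.powerset, ∀ p ∈ I, p.Prime := fun I hI p hp =>
    Nat.prime_of_mem_primeFactors (mem_powerset.1 hI hp)
  rw [prod_one_add]
  calc ∑ I ∈ n.primeFactors.powerset, ∏ p ∈ I, (√(p : ℝ))⁻¹
      = ∑ I ∈ n.primeFactors.powerset, (fun d : ℕ => (√(d : ℝ))⁻¹) (∏ p ∈ I, p) := by
        refine sum_congr rfl fun I _ => ?_
        simp only
        rw [prod_inv_distrib, Nat.cast_prod, Real.sqrt_prod _ fun p _ => Nat.cast_nonneg p]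
    _ = ∑ d ∈ n.primeFactors.powerset.image (fun I => ∏ p ∈ I, p), (√(d : ℝ))⁻¹ := by
        refine (sum_image (f := fun d : ℕ => (√(d : ℝ))⁻¹) ?_).symm
        intro I hI J hJ h
        simp only at h
        rw [← Nat.primeFactors_prod (hpp I hI), h, Nat.primeFactors_prod (hpp J hJ)]
    _ ≤ _ := by
        refine sum_le_sum_of_subset_of_nonneg ?_ fun _ _ _ => by positivity
        intro d hd
        obtain ⟨I, hI, rfl⟩ := mem_image.1 hd
        exact Nat.mem_divisors.2 ⟨(prod_dvd_prod_of_subset _ _ _ (mem_powerset.1 hI)).trans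
          (Nat.prod_primeFactors_dvd n), hn⟩

/-- For `p > 4 A²`, Bernoulli's inequality gives `(1 - 1 / p) ^ (-A) ≤ 1 + p ^ (-1 / 2)`; the finitely
many smaller primes cost a bounded factor each. -/
theorem inv_one_sub_inv_pow_le {p : ℕ} (hp : p.Prime) (A : ℕ) :
    ((1 - (p : ℝ)⁻¹)⁻¹) ^ A ≤ (if p < 4 * A ^ 2 + 1 then 2 ^ A else 1) * (1 + (√(p : ℝ))⁻¹) := by
  have hp2 : (2 : ℝ) ≤ p := by exact_mod_cast hp.two_le
  have hp0 : (0 : ℝ) < p := by linarith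
  have hpi : (p : ℝ)⁻¹ ≤ 1 / 2 := by
    rw [inv_le_comm₀ hp0 (by norm_num)]; linarith
  have hpi0 : (0 : ℝ) < (p : ℝ)⁻¹ := by positivity
  split_ifs with h
  · calc ((1 - (p : ℝ)⁻¹)⁻¹) ^ A ≤ 2 ^ A := by
          refine pow_le_pow_left₀ (inv_nonneg.2 (by linarith)) ?_ A
          rw [inv_le_comm₀ (by linarith) (by norm_num)]; linarith
      _ ≤ _ := le_mul_of_one_le_right (by positivity) (by
          linarith [inv_nonneg.2 (Real.sqrt_nonneg p)])
  · rw [one_mul, inv_pow]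
    have hA : (2 * A : ℝ) ≤ √p := by
      apply Real.le_sqrt_of_sq_le
      have : 4 * A ^ 2 ≤ p := by omega
      have : ((4 * A ^ 2 : ℕ) : ℝ) ≤ p := by exact_mod_cast this
      push_cast at this
      nlinarith
    set r := √(p : ℝ) with hr
    have hr1 : 1 ≤ r := Real.one_le_sqrt.2 (by linarith)
    have hrr : (p : ℝ) = r * r := (Real.mul_self_sqrt hp0.le).symm
    have hbern : 1 - A * (p : ℝ)⁻¹ ≤ (1 - (p : ℝ)⁻¹) ^ A := by
      have := one_add_mul_le_pow (a := -(p : ℝ)⁻¹) (by linarith) A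
      rw [← sub_eq_add_neg] at this
      linarith
    rw [inv_le_iff_one_le_mul₀' (pow_pos (by linarith) A)]
    refine le_trans ?_ (mul_le_mul_of_nonneg_right hbern (by positivity))
    rw [hrr]
    have hr0 : r ≠ 0 := by linarith
    have hA0 : (0 : ℝ) ≤ A := Nat.cast_nonneg A
    have : (1 - A * (r * r)⁻¹) * (1 + r⁻¹) - 1 = (r * r - A * r - A) / (r * r * r) := by
      field_simp
      ring
    have h2 : 0 ≤ (r * r - A * r - A) / (r * r * r) := by
      apply div_nonneg _ (by positivity)
      nlinarith
    linarith

/-- The weights `d ^ (-1 / 2)` make the sum over `d ∣ D` bounded on average over `D`. -/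
theorem exists_eulerFactor_pow_le (A : ℕ) : ∃ C : ℝ, 0 < C ∧ ∀ D : ℤ, D ≠ 0 →
    eulerFactor D ^ A ≤ C * ∑ d ∈ D.natAbs.divisors, (√(d : ℝ))⁻¹ := by
  refine ⟨(2 ^ A) ^ (4 * A ^ 2 + 1), by positivity, fun D hD => ?_⟩
  have hn : D.natAbs ≠ 0 := by omega
  rw [eulerFactor, ← prod_pow]
  calc ∏ p ∈ D.natAbs.primeFactors, ((1 - (p : ℝ)⁻¹)⁻¹) ^ A
      ≤ ∏ p ∈ D.natAbs.primeFactors,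
        ((if p < 4 * A ^ 2 + 1 then 2 ^ A else 1) * (1 + (√(p : ℝ))⁻¹)) :=
        prod_le_prod (fun p hp => pow_nonneg (by
          linarith [one_le_inv_one_sub_inv (Nat.prime_of_mem_primeFactors hp)]) A)
          fun p hp => inv_one_sub_inv_pow_le (Nat.prime_of_mem_primeFactors hp) A
    _ ≤ _ := by
        rw [prod_mul_distrib, prod_ite, prod_const, prod_const_one, mul_one]
        have h1 : (D.natAbs.primeFactors.filter (· < 4 * A ^ 2 + 1)).card ≤ 4 * A ^ 2 + 1 := by
          have : (D.natAbs.primeFactors.filter (· < 4 * A ^ 2 + 1)) ⊆ range (4 * A ^ 2 + 1) :=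
            fun p hp => mem_range.2 (mem_filter.1 hp).2
          simpa using card_le_card this
        have h2 : (1 : ℝ) ≤ 2 ^ A := one_le_pow₀ (by norm_num)
        refine mul_le_mul (pow_le_pow_right₀ h2 h1) (prod_one_add_inv_sqrt_le hn) ?_ (by positivity)
        exact prod_nonneg fun p _ => by positivity

theorem exists_sum_divisors_inv_sqrt_le : ∃ C : ℝ, 0 < C ∧ ∀ Y : ℕ,
    ∑ n ∈ Icc 1 Y, ∑ d ∈ n.divisors, (√(d : ℝ))⁻¹ ≤ C * Y := by
  have hsum : Summable fun d : ℕ => 1 / (d : ℝ) ^ (3 / 2 : ℝ) :=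
    Real.summable_one_div_nat_rpow.2 (by norm_num)
  have hnn : ∀ d : ℕ, 0 ≤ 1 / (d : ℝ) ^ (3 / 2 : ℝ) := fun d => by positivity
  have ht : 0 ≤ ∑' d : ℕ, 1 / (d : ℝ) ^ (3 / 2 : ℝ) := tsum_nonneg hnn
  refine ⟨(∑' d : ℕ, 1 / (d : ℝ) ^ (3 / 2 : ℝ)) + 1, by linarith, fun Y => ?_⟩
  have h1 : ∀ n ∈ Icc 1 Y, ∑ d ∈ n.divisors, (√(d : ℝ))⁻¹ =
      ∑ d ∈ Icc 1 Y, if d ∣ n then (√(d : ℝ))⁻¹ else 0 := by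
    intro n hn
    rw [mem_Icc] at hn
    rw [← sum_filter]
    refine sum_congr ?_ fun _ _ => rfl
    ext d
    rw [Nat.mem_divisors, mem_filter, mem_Icc]
    constructor
    · rintro ⟨hd, h0⟩
      have := Nat.le_of_dvd hn.1 hd
      have := Nat.pos_of_dvd_of_pos hd hn.1
      exact ⟨⟨by omega, by omega⟩, hd⟩
    · rintro ⟨-, hd⟩
      exact ⟨hd, by omega⟩
  rw [sum_congr rfl h1, sum_comm]
  calc ∑ d ∈ Icc 1 Y, ∑ n ∈ Icc 1 Y, (if d ∣ n then (√(d : ℝ))⁻¹ else 0)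
      ≤ ∑ d ∈ Icc 1 Y, (Y : ℝ) * (1 / (d : ℝ) ^ (3 / 2 : ℝ)) := by
        refine sum_le_sum fun d hd => ?_
        have hd0 : (0 : ℝ) < d := by exact_mod_cast (mem_Icc.1 hd).1
        rw [← sum_filter, sum_const, nsmul_eq_mul]
        have hc : ((Icc 1 Y).filter (d ∣ ·)).card = Y / d := by
          rw [← Nat.Ioc_filter_dvd_card_eq_div]; rfl
        have hle : ((Y / d : ℕ) : ℝ) ≤ Y / d := Nat.cast_div_le
        rw [hc]
        calc ((Y / d : ℕ) : ℝ) * (√(d : ℝ))⁻¹ ≤ Y / d * (√(d : ℝ))⁻¹ := by gcongr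
          _ = _ := by
            rw [show (3 / 2 : ℝ) = 1 + 1 / 2 by norm_num, Real.rpow_add hd0, Real.rpow_one,
              ← Real.sqrt_eq_rpow]
            field_simp
    _ = (∑ d ∈ Icc 1 Y, 1 / (d : ℝ) ^ (3 / 2 : ℝ)) * Y := by rw [← mul_sum, mul_comm]
    _ ≤ _ := by
        gcongr
        linarith [hsum.sum_le_tsum (Icc 1 Y) fun d _ => hnn d]

/-- Powers of the Euler factor `eulerFactor D` are bounded on average over `0 < |D| ≤ Y`. -/
theorem exists_sum_eulerFactor_pow_le (A : ℕ) : ∃ C : ℝ, 0 < C ∧ ∀ Y : ℕ,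
    ∑ D ∈ (Icc (-(Y : ℤ)) Y).erase 0, eulerFactor D ^ A ≤ C * Y := by
  classical
  obtain ⟨C₁, hC₁, h₁⟩ := exists_eulerFactor_pow_le A
  obtain ⟨C₂, hC₂, h₂⟩ := exists_sum_divisors_inv_sqrt_le
  refine ⟨2 * C₁ * C₂, by positivity, fun Y => ?_⟩
  set f : ℕ → ℝ := fun n => ∑ d ∈ n.divisors, (√(d : ℝ))⁻¹ with hf
  have hf0 : ∀ n, 0 ≤ f n := fun n => sum_nonneg fun _ _ => by positivity
  have hsub : (Icc (-(Y : ℤ)) Y).erase 0 ⊆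
      (Icc 1 Y).image (fun n : ℕ => (n : ℤ)) ∪ (Icc 1 Y).image (fun n : ℕ => -(n : ℤ)) := by
    intro D hD
    rw [mem_erase, mem_Icc] at hD
    rw [mem_union, mem_image, mem_image]
    rcases lt_or_gt_of_ne hD.1 with h | h
    · exact Or.inr ⟨D.natAbs, mem_Icc.2 ⟨by omega, by omega⟩, by omega⟩
    · exact Or.inl ⟨D.natAbs, mem_Icc.2 ⟨by omega, by omega⟩, by omega⟩
  calc ∑ D ∈ (Icc (-(Y : ℤ)) Y).erase 0, eulerFactor D ^ A
      ≤ ∑ D ∈ (Icc (-(Y : ℤ)) Y).erase 0, C₁ * f D.natAbs :=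
        sum_le_sum fun D hD => h₁ D (mem_erase.1 hD).1
    _ = C₁ * ∑ D ∈ (Icc (-(Y : ℤ)) Y).erase 0, f D.natAbs := by rw [mul_sum]
    _ ≤ C₁ * (∑ n ∈ Icc 1 Y, f n + ∑ n ∈ Icc 1 Y, f n) := by
        refine mul_le_mul_of_nonneg_left ?_ hC₁.le
        refine (sum_le_sum_of_subset_of_nonneg hsub fun _ _ _ => hf0 _).trans ?_
        refine (le_add_of_nonneg_right (sum_nonneg fun D _ => hf0 D.natAbs)).trans
          (sum_union_inter (f := fun D : ℤ => f D.natAbs)).le |>.trans ?_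
        rw [sum_image (fun _ _ _ _ h => by simpa using h),
          sum_image (fun _ _ _ _ h => by simpa using h)]
        simp
    _ ≤ C₁ * (C₂ * Y + C₂ * Y) := by
        gcongr <;> exact h₂ Y
    _ = _ := by ring

end Correlations

/-! ### Expansion of the moment -/

section Expansion

open Finset MeasureTheory

/-- The signs `+1` on the first and `-1` on the second copy of `Fin k`. -/
def copySign (k : ℕ) : Fin k ⊕ Fin k → ℤ := Sum.elim (fun _ => 1) (fun _ => -1)

theorem sum_copySign (k : ℕ) : ∑ i, copySign k i = 0 := by
  simp [copySign, Fintype.sum_sum_type]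

/-- The product `∏ⱼ Λ(n + aⱼ)`. -/
noncomputable def tupleWeight {l : ℕ} (a : Fin l → ℤ) (n : ℤ) : ℝ :=
  ∏ j, vonMangoldtInt (n + a j)

theorem tupleWeight_nonneg {l : ℕ} (a : Fin l → ℤ) (n : ℤ) : 0 ≤ tupleWeight a n :=
  prod_nonneg fun _ _ => vonMangoldtInt_nonneg _

theorem integral_additiveChar_mul (m : ℤ) :
    ∫ α in (0 : ℝ)..1, additiveChar (α * m) = if m = 0 then 1 else 0 := by
  split_ifs with h
  · simp [h, additiveChar]
  · have hc : (2 * Real.pi * Complex.I * m : ℂ) ≠ 0 := by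
      simp [Real.pi_ne_zero, h]
    have h1 := integral_exp_mul_complex (a := 0) (b := 1) hc
    have h2 : ∀ α : ℝ, additiveChar (α * m) =
        Complex.exp (2 * Real.pi * Complex.I * m * α) := fun α => by
      rw [additiveChar]; push_cast; congr 1; ring
    simp only [h2]
    rw [h1]
    have h3 : Complex.exp (2 * Real.pi * Complex.I * m * (1 : ℝ)) = 1 := by
      rw [← Complex.exp_int_mul_two_pi_mul_I m]; congr 1; push_cast; ring
    rw [h3]; simp

theorem additiveChar_add (s t : ℝ) : additiveChar (s + t) = additiveChar s * additiveChar t := by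
  rw [additiveChar, additiveChar, additiveChar, ← Complex.exp_add]; push_cast; congr 1; ring

theorem additiveChar_sum {α : Type*} (s : Finset α) (t : α → ℝ) :
    additiveChar (∑ i ∈ s, t i) = ∏ i ∈ s, additiveChar (t i) := by
  classical
  induction s using Finset.induction_on with
  | empty => simp [additiveChar]
  | insert i s hi ih => rw [sum_insert hi, prod_insert hi, additiveChar_add, ih]

theorem conj_additiveChar (t : ℝ) : (starRingEnd ℂ) (additiveChar t) = additiveChar (-t) := by
  rw [additiveChar, additiveChar, ← Complex.exp_conj]
  simp [map_ofNat (starRingEnd ℂ) 2]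

theorem continuous_additiveChar_mul (m : ℤ) : Continuous fun α : ℝ => additiveChar (α * m) := by
  unfold additiveChar; fun_prop

/-- The `2k`-th moment of an exponential sum is at most the weighted number of solutions of
`u₁ + ⋯ + u_k = u_{k+1} + ⋯ + u_{2k}`. -/
theorem integral_norm_pow_le (k : ℕ) (s : Finset ℤ) (w : ℤ → ℂ) :
    ∫ α in (0 : ℝ)..1, ‖∑ n ∈ s, w n * additiveChar (α * n)‖ ^ (2 * k) ≤
      ∑ u ∈ (Fintype.piFinset fun _ : Fin k ⊕ Fin k => s).filter
        (fun u => ∑ i, copySign k i * u i = 0), ∏ i, ‖w (u i)‖ := by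
  set W : (Fin k ⊕ Fin k → ℤ) → ℂ := fun u =>
    ∏ i, Sum.elim (fun _ => w (u i)) (fun _ => (starRingEnd ℂ) (w (u i))) i with hW
  have hexp : ∀ α : ℝ, ((‖∑ n ∈ s, w n * additiveChar (α * n)‖ ^ (2 * k) : ℝ) : ℂ) =
      ∑ u ∈ Fintype.piFinset fun _ : Fin k ⊕ Fin k => s,
        W u * additiveChar (α * ((∑ i, copySign k i * u i : ℤ) : ℝ)) := by
    intro α
    set S := ∑ n ∈ s, w n * additiveChar (α * n) with hS
    have h1 : ((‖S‖ ^ (2 * k) : ℝ) : ℂ) =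
        ∏ i : Fin k ⊕ Fin k, ∑ n ∈ s, Sum.elim (fun _ => w n) (fun _ => (starRingEnd ℂ) (w n)) i *
          additiveChar (α * (copySign k i * n)) := by
      rw [Fintype.prod_sum_type, pow_mul]
      simp only [Sum.elim_inl, Sum.elim_inr, copySign, prod_const, card_univ, Fintype.card_fin]
      rw [← mul_pow]
      push_cast
      congr 1
      rw [← Complex.mul_conj']
      congr 1
      · simp [hS]
      · rw [hS, map_sum]
        refine sum_congr rfl fun n _ => ?_
        rw [map_mul, conj_additiveChar]
        congr 2
        ring
    rw [h1, prod_univ_sum]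
    refine sum_congr rfl fun u _ => ?_
    rw [prod_mul_distrib, ← additiveChar_sum, ← mul_sum]
    push_cast
    rfl
  have hint : ((∫ α in (0 : ℝ)..1, ‖∑ n ∈ s, w n * additiveChar (α * n)‖ ^ (2 * k) : ℝ) : ℂ) =
      ∑ u ∈ (Fintype.piFinset fun _ : Fin k ⊕ Fin k => s).filter
        (fun u => ∑ i, copySign k i * u i = 0), W u := by
    rw [← intervalIntegral.integral_ofReal]
    simp only [hexp]
    rw [intervalIntegral.integral_finsetSum fun u _ =>
      ((continuous_additiveChar_mul _).const_mul (W u)).intervalIntegrable _ _, sum_filter]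
    refine sum_congr rfl fun u _ => ?_
    rw [intervalIntegral.integral_const_mul, integral_additiveChar_mul]
    split_ifs <;> simp
  have hre := congrArg Complex.re hint
  rw [Complex.ofReal_re] at hre
  rw [hre]
  refine (Complex.re_le_norm _).trans ((norm_sum_le _ _).trans (sum_le_sum fun u _ => ?_))
  rw [hW, norm_prod]
  refine prod_le_prod (fun _ _ => norm_nonneg _) fun i _ => ?_
  rcases i with i | i <;> simp

/-- The tuples `u ∈ [0, Y]^{2k}` whose first and second halves have equal sums. -/
noncomputable def balancedTuples (k Y : ℕ) : Finset (Fin k ⊕ Fin k → ℤ) :=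
  (Fintype.piFinset fun _ => Icc (0 : ℤ) Y).filter fun u => ∑ i, copySign k i * u i = 0

theorem integral_shortExpSum_le {l : ℕ} (a : Fin l → ℤ) (g : ℤ → ℂ) (k : ℕ) {H : ℝ}
    (hH : 0 ≤ H) (hg : ∀ n, ‖g n‖ ≤ 1) (x : ℝ) :
    ∫ α in (0 : ℝ)..1, ‖shortExpSum a g H x α‖ ^ (2 * k) ≤
      ∑ u ∈ balancedTuples k ⌊H⌋₊, ∏ i, tupleWeight a (⌈x⌉ + u i) := by
  classical
  set w : ℤ → ℂ := fun n => g n * ∏ j : Fin l, (vonMangoldtInt (n + a j) : ℂ) with hw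
  have hwn : ∀ n, ‖w n‖ ≤ tupleWeight a n := fun n => by
    rw [hw, norm_mul, tupleWeight, norm_prod]
    refine (mul_le_of_le_one_left (prod_nonneg fun _ _ => norm_nonneg _) (hg n)).trans ?_
    refine prod_le_prod (fun _ _ => norm_nonneg _) fun j _ => ?_
    rw [Complex.norm_real, Real.norm_of_nonneg (vonMangoldtInt_nonneg _)]
  have h1 := integral_norm_pow_le k (Icc ⌈x⌉ ⌊x + H⌋) w
  have h2 : ∀ α : ℝ, shortExpSum a g H x α =
      ∑ n ∈ Icc ⌈x⌉ ⌊x + H⌋, w n * additiveChar (α * n) := fun α => by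
    refine sum_congr rfl fun n _ => ?_
    rw [hw]; ring
  simp only [h2]
  refine h1.trans ?_
  refine (sum_le_sum fun u _ => prod_le_prod (fun _ _ => norm_nonneg _)
    fun i _ => hwn (u i)).trans ?_
  rw [← sum_image (s := balancedTuples k ⌊H⌋₊) (f := fun u => ∏ i, tupleWeight a (u i))
    (g := fun u i => ⌈x⌉ + u i)]
  · refine sum_le_sum_of_subset_of_nonneg ?_ fun u _ _ =>
      prod_nonneg fun i _ => tupleWeight_nonneg _ _
    intro u hu
    obtain ⟨hu1, hu2⟩ := mem_filter.1 hu
    rw [Fintype.mem_piFinset] at hu1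
    refine mem_image.2 ⟨fun i => u i - ⌈x⌉, mem_filter.2 ⟨?_, ?_⟩, ?_⟩
    · rw [Fintype.mem_piFinset]
      intro i
      obtain ⟨h3, h4⟩ := mem_Icc.1 (hu1 i)
      rw [mem_Icc]
      refine ⟨by omega, ?_⟩
      have h5 : (u i : ℝ) ≤ x + H := Int.le_floor.1 h4
      have h6 : ((u i - ⌈x⌉ : ℤ) : ℝ) ≤ H := by
        push_cast; linarith [Int.le_ceil x]
      rw [Int.natCast_floor_eq_floor hH]
      exact Int.le_floor.2 h6
    · simp only [mul_sub, sum_sub_distrib, ← sum_mul, sum_copySign, hu2]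
      simp
    · funext i; simp
  · intro u _ v _ h
    funext i
    simpa using congrFun h i

theorem ceil_eq_of_mem_uIoc {n : ℕ} {x : ℝ} (hx : x ∈ Set.uIoc (n : ℝ) (n + 1 : ℕ)) :
    ⌈x⌉ = (n : ℤ) + 1 := by
  rw [Set.uIoc_of_le (by push_cast; linarith), Set.mem_Ioc] at hx
  rw [Int.ceil_eq_iff]
  push_cast at hx ⊢
  constructor <;> linarith [hx.1, hx.2]

theorem intervalIntegrable_comp_ceil (φ : ℤ → ℝ) (n : ℕ) :
    IntervalIntegrable (fun x : ℝ => φ ⌈x⌉) volume (n : ℝ) (n + 1 : ℕ) := by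
  refine (intervalIntegrable_const (c := φ (n + 1))).congr fun x hx => ?_
  simp only [ceil_eq_of_mem_uIoc hx]

theorem integral_comp_ceil (φ : ℤ → ℝ) (n : ℕ) :
    ∫ x in (n : ℝ)..(n + 1 : ℕ), φ ⌈x⌉ = φ (n + 1) := by
  have : ∫ x in (n : ℝ)..(n + 1 : ℕ), φ ⌈x⌉ = ∫ x in (n : ℝ)..(n + 1 : ℕ), φ (n + 1) :=
    intervalIntegral.integral_congr_ae (Filter.Eventually.of_forall fun x hx => by
      simp only [ceil_eq_of_mem_uIoc hx])
  rw [this]; simp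

/-- The moment is at most a sum, over tuples of bounded balanced shifts, of correlations. -/
theorem shortExpSumMoment_le {l : ℕ} (a : Fin l → ℤ) (g : ℤ → ℂ) (k : ℕ) {X H : ℝ}
    (hX : 0 ≤ X) (hH : 0 ≤ H) (hg : ∀ n, ‖g n‖ ≤ 1) :
    shortExpSumMoment a g k X H ≤
      ∑ u ∈ balancedTuples k ⌊H⌋₊, ∑ n ∈ range ⌈X⌉₊, ∏ i, tupleWeight a (n + 1 + u i) := by
  set φ : ℤ → ℝ := fun m => ∑ u ∈ balancedTuples k ⌊H⌋₊, ∏ i, tupleWeight a (m + u i) with hφ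
  have hφ0 : ∀ m, 0 ≤ φ m := fun m => sum_nonneg fun u _ =>
    prod_nonneg fun i _ => tupleWeight_nonneg _ _
  have hI : IntervalIntegrable (fun x : ℝ => φ ⌈x⌉) volume (0 : ℝ) ⌈X⌉₊ := by
    have := IntervalIntegrable.trans_iterate (a := fun n : ℕ => (n : ℝ)) (n := ⌈X⌉₊)
      (μ := volume) (f := fun x : ℝ => φ ⌈x⌉) fun n _ => intervalIntegrable_comp_ceil φ n
    simpa using this
  have hXN : X ≤ ⌈X⌉₊ := Nat.le_ceil X
  have hsub : Set.uIcc (0 : ℝ) X ⊆ Set.uIcc (0 : ℝ) ⌈X⌉₊ := by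
    rw [Set.uIcc_of_le hX, Set.uIcc_of_le (hX.trans hXN)]
    exact Set.Icc_subset_Icc_right hXN
  calc shortExpSumMoment a g k X H ≤ ∫ x in (0 : ℝ)..X, φ ⌈x⌉ := by
        rw [shortExpSumMoment, intervalIntegral.integral_of_le hX,
          intervalIntegral.integral_of_le hX]
        refine integral_mono_of_nonneg (Filter.Eventually.of_forall fun x => ?_) ?_
          (Filter.Eventually.of_forall fun x => integral_shortExpSum_le a g k hH hg x)
        · exact intervalIntegral.integral_nonneg zero_le_one fun α _ => by positivity
        · exact (intervalIntegrable_iff_integrableOn_Ioc_of_le hX).1 (hI.mono_set hsub)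
    _ ≤ ∫ x in (0 : ℝ)..⌈X⌉₊, φ ⌈x⌉ :=
        intervalIntegral.integral_mono_interval le_rfl hX hXN
          (Filter.Eventually.of_forall fun x => hφ0 _) hI
    _ = ∑ n ∈ range ⌈X⌉₊, φ (n + 1) := by
        have := intervalIntegral.sum_integral_adjacent_intervals (a := fun n : ℕ => (n : ℝ))
          (n := ⌈X⌉₊) (μ := volume) (f := fun x : ℝ => φ ⌈x⌉)
          fun n _ => intervalIntegrable_comp_ceil φ n
        simp only [integral_comp_ceil] at this
        simpa using this.symm
    _ = _ := by
        rw [hφ, sum_comm]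

end Expansion

/-! ### Counting tuples of a given pattern -/

section Patterns

open Finset

/-- A power of the Euler factor, extended by zero to `D = 0`. -/
noncomputable def eulerPow (m : ℕ) (D : ℤ) : ℝ := if D = 0 then 0 else eulerFactor D ^ m

theorem eulerPow_nonneg (m : ℕ) (D : ℤ) : 0 ≤ eulerPow m D := by
  unfold eulerPow
  split_ifs
  · exact le_rfl
  · exact pow_nonneg (zero_le_one.trans (one_le_eulerFactor D)) m

theorem exists_sum_eulerPow_le (m : ℕ) : ∃ C : ℝ, 0 < C ∧ ∀ Y : ℕ,
    ∑ D ∈ Icc (-(Y : ℤ)) Y, eulerPow m D ≤ C * Y := by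
  obtain ⟨C, hC, h⟩ := exists_sum_eulerFactor_pow_le m
  refine ⟨C, hC, fun Y => le_trans (le_of_eq ?_) (h Y)⟩
  rw [← sum_erase (Icc (-(Y : ℤ)) Y) (show eulerPow m 0 = 0 by simp [eulerPow])]
  refine sum_congr rfl fun D hD => ?_
  rw [eulerPow, if_neg (mem_erase.1 hD).1]

variable {ι : Type*} [DecidableEq ι]

theorem card_le_pow_of_determined {S : Finset (ι → ℤ)} {Y : ℕ}
    (hS : ∀ u ∈ S, ∀ i, u i ∈ Icc (0 : ℤ) Y) {R : Finset ι}
    (hR : ∀ u ∈ S, ∀ v ∈ S, (∀ i ∈ R, u i = v i) → u = v) :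
    S.card ≤ (Y + 1) ^ R.card := by
  have h := card_le_card_of_injOn (s := S)
    (t := Fintype.piFinset fun _ : R => Icc (0 : ℤ) Y) (fun u i => u i)
    (fun u hu => Fintype.mem_piFinset.2 fun i => hS u hu i)
    (fun u hu v hv huv => hR u hu v hv fun i hi => congrFun huv ⟨i, hi⟩)
  simpa using h

/-- The difference of two of the coordinates that determine `u` may replace one of them. -/
theorem sum_comp_sub_le_of_determined {S : Finset (ι → ℤ)} {Y A : ℕ}
    (hS : ∀ u ∈ S, ∀ i, u i ∈ Icc (0 : ℤ) Y) {R : Finset ι}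
    (hR : ∀ u ∈ S, ∀ v ∈ S, (∀ i ∈ R, u i = v i) → u = v) {t t' : ι} (ht : t ∈ R)
    (ht' : t' ∈ R) (htt' : t ≠ t') {e : ℤ} (he : |e| ≤ A) {Q : ℤ → ℝ} (hQ : ∀ D, 0 ≤ Q D) :
    ∑ u ∈ S, Q (u t - u t' + e) ≤
      ((Y : ℝ) + 1) ^ (R.card - 1) * ∑ D ∈ Icc (-((Y + A : ℕ) : ℤ)) (Y + A : ℕ), Q D := by
  set φ : (ι → ℤ) → ℤ × (R.erase t → ℤ) := fun u => (u t - u t' + e, fun i => u i) with hφ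
  have hinj : Set.InjOn φ S := by
    intro u hu v hv huv
    simp only [hφ, Prod.mk.injEq] at huv
    have h1 : ∀ i ∈ R, i ≠ t → u i = v i := fun i hi hit =>
      congrFun huv.2 ⟨i, mem_erase.2 ⟨hit, hi⟩⟩
    refine hR u hu v hv fun i hi => ?_
    by_cases hit : i = t
    · have h2 := h1 t' ht' htt'.symm
      have h3 := huv.1
      rw [hit]; linarith
    · exact h1 i hi hit
  calc ∑ u ∈ S, Q (u t - u t' + e) = ∑ u ∈ S, (fun x : ℤ × (R.erase t → ℤ) => Q x.1) (φ u) := rfl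
    _ = ∑ x ∈ S.image φ, Q x.1 :=
        (sum_image (f := fun x : ℤ × (R.erase t → ℤ) => Q x.1) hinj).symm
    _ ≤ ∑ x ∈ Icc (-((Y + A : ℕ) : ℤ)) (Y + A : ℕ) ×ˢ
          (Fintype.piFinset fun _ : R.erase t => Icc (0 : ℤ) Y), Q x.1 := by
        refine sum_le_sum_of_subset_of_nonneg ?_ fun x _ _ => hQ _
        intro x hx
        obtain ⟨u, hu, rfl⟩ := mem_image.1 hx
        refine mem_product.2 ⟨?_, Fintype.mem_piFinset.2 fun i => hS u hu i⟩
        have h1 := mem_Icc.1 (hS u hu t)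
        have h2 := mem_Icc.1 (hS u hu t')
        rw [abs_le] at he
        rw [mem_Icc]
        push_cast
        constructor <;> simp only [hφ] <;> linarith [h1.1, h1.2, h2.1, h2.2, he.1, he.2]
    _ = _ := by
        rw [sum_product]
        simp only [sum_const, nsmul_eq_mul, Fintype.card_piFinset, prod_const]
        rw [← mul_sum]
        simp [card_erase_of_mem ht]

/-- The mean value of `eulerPow m (u t - u t' + e)` over tuples determined by `d` coordinates is
bounded, provided that `t` and `t'` are two of these coordinates or that `u t - u t'` is bounded. -/
theorem exists_sum_eulerPow_le_of_determined (m A M d : ℕ) :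
    ∃ C : ℝ, 0 < C ∧ ∀ H : ℝ, 2 ≤ H → ∀ (S : Finset (ι → ℤ)) (R : Finset ι) (t t' : ι) (e : ℤ),
      (∀ u ∈ S, ∀ i, u i ∈ Icc (0 : ℤ) ⌊H⌋₊) →
      (∀ u ∈ S, ∀ v ∈ S, (∀ i ∈ R, u i = v i) → u = v) → R.card = d → |e| ≤ A →
      ((t ∈ R ∧ t' ∈ R ∧ t ≠ t') ∨ ∀ u ∈ S, |u t - u t' + e| ≤ M) →
      ∑ u ∈ S, eulerPow m (u t - u t' + e) ≤ C * H ^ d := by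
  obtain ⟨C, hC, h⟩ := exists_sum_eulerPow_le m
  refine ⟨2 ^ d * (C * (1 + A)) + 2 ^ d * (C * M), by positivity, ?_⟩
  intro H hH S R t t' e hS hR hd he hor
  have hY : ((⌊H⌋₊ : ℕ) : ℝ) ≤ H := Nat.floor_le (by linarith)
  have hA0 : (0 : ℝ) ≤ A := Nat.cast_nonneg A
  rcases hor with ⟨ht, ht', hne⟩ | hb
  · have hd1 : d = (R.card - 1) + 1 := by
      have := card_pos.2 ⟨t, ht⟩
      omega
    calc ∑ u ∈ S, eulerPow m (u t - u t' + e) ≤ _ :=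
          sum_comp_sub_le_of_determined hS hR ht ht' hne he (eulerPow_nonneg m)
      _ ≤ (2 * H) ^ (R.card - 1) * (2 * (C * (1 + A) * H)) := by
          refine mul_le_mul (pow_le_pow_left₀ (by positivity) (by linarith) _) ?_
            (sum_nonneg fun _ _ => eulerPow_nonneg _ _) (by positivity)
          refine (h _).trans ?_
          have h1 : ((⌊H⌋₊ + A : ℕ) : ℝ) ≤ (1 + A) * H := by push_cast; nlinarith
          have h2 : C * ((⌊H⌋₊ + A : ℕ) : ℝ) ≤ C * ((1 + A) * H) := by gcongr
          have h3 : 0 ≤ C * (1 + A) * H := by positivity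
          linarith
      _ = 2 ^ d * (C * (1 + A)) * H ^ d := by
          rw [mul_pow, hd1]
          ring
      _ ≤ _ := by
          rw [add_mul]
          exact le_add_of_nonneg_right (by positivity)
  · have hcard : (S.card : ℝ) ≤ (2 * H) ^ d := by
      have h1 := card_le_pow_of_determined hS hR
      have h2 : (S.card : ℝ) ≤ ((⌊H⌋₊ : ℝ) + 1) ^ R.card := by exact_mod_cast h1
      rw [hd] at h2
      exact h2.trans (pow_le_pow_left₀ (by positivity) (by linarith) _)
    calc ∑ u ∈ S, eulerPow m (u t - u t' + e) ≤ S.card • (C * M) := by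
          refine sum_le_card_nsmul _ _ _ fun u hu => le_trans ?_ (h M)
          refine single_le_sum (f := fun D => eulerPow m D) (fun D _ => eulerPow_nonneg _ _) ?_
          exact mem_Icc.2 (abs_le.1 (hb u hu))
      _ ≤ (2 * H) ^ d * (C * M) := by
          rw [nsmul_eq_mul]
          exact mul_le_mul_of_nonneg_right hcard (by positivity)
      _ = 2 ^ d * (C * M) * H ^ d := by rw [mul_pow]; ring
      _ ≤ _ := by
          rw [add_mul]
          exact le_add_of_nonneg_left (by positivity)

variable [Fintype ι]

/-- A maximal set of coordinates of `u` that differ pairwise by more than `A`: every coordinate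
is within `A` of one of them. -/
theorem exists_separated_representatives (A : ℕ) (u : ι → ℤ) :
    ∃ T : Finset ι, (∀ t ∈ T, ∀ t' ∈ T, t ≠ t' → (A : ℤ) < |u t - u t'|) ∧
      ∀ i, ∃ t ∈ T, |u i - u t| ≤ A := by
  classical
  obtain ⟨T, hT, hmax⟩ := exists_max_image
    ((univ : Finset (Finset ι)).filter
      fun T => ∀ t ∈ T, ∀ t' ∈ T, t ≠ t' → (A : ℤ) < |u t - u t'|) card
    ⟨∅, by simp⟩
  have hsep := (mem_filter.1 hT).2
  refine ⟨T, hsep, fun i => ?_⟩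
  by_contra hcon
  push Not at hcon
  have hiT : i ∉ T := fun hi => by
    have := hcon i hi
    simp at this
    omega
  have := hmax (insert i T) (mem_filter.2 ⟨mem_univ _, ?_⟩)
  · rw [card_insert_of_notMem hiT] at this
    omega
  · intro t ht t' ht' hne
    rcases mem_insert.1 ht with h1 | h1 <;> rcases mem_insert.1 ht' with h2 | h2
    · exact absurd (h1.trans h2.symm) hne
    · rw [h1]; exact hcon t' h2
    · rw [h2, abs_sub_comm]; exact hcon t h1
    · exact hsep t h1 t' h2 hne

/-- The balanced tuples with the pattern `(T, π, β)`: the coordinates in `T` are more than `A`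
apart, and the coordinate `i` is obtained from the one at `π i` by adding `β i`. -/
noncomputable def patternTuples (k A Y : ℕ) (T : Finset (Fin k ⊕ Fin k))
    (π : Fin k ⊕ Fin k → Fin k ⊕ Fin k) (β : Fin k ⊕ Fin k → ℤ) :
    Finset (Fin k ⊕ Fin k → ℤ) :=
  (balancedTuples k Y).filter fun u => (∀ i, u i = u (π i) + β i) ∧
    ∀ t ∈ T, ∀ t' ∈ T, t ≠ t' → (A : ℤ) < |u t - u t'|

/-- The coefficient of the coordinate `t` in the balancing equation of a pattern. -/
def patternCoeff {k : ℕ} (π : Fin k ⊕ Fin k → Fin k ⊕ Fin k) (t : Fin k ⊕ Fin k) : ℤ :=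
  ∑ i ∈ univ.filter (fun i => π i = t), copySign k i

section

variable {k A Y : ℕ} {T : Finset (Fin k ⊕ Fin k)} {π : Fin k ⊕ Fin k → Fin k ⊕ Fin k}
  {β : Fin k ⊕ Fin k → ℤ}

theorem sum_patternCoeff_mul (hπ : ∀ i, π i ∈ T) (f : Fin k ⊕ Fin k → ℤ) :
    ∑ t ∈ T, patternCoeff π t * f t = ∑ i, copySign k i * f (π i) := by
  rw [← sum_fiberwise_of_maps_to (s := univ) (t := T) (g := π) fun i _ => hπ i]
  refine sum_congr rfl fun t _ => ?_
  rw [patternCoeff, sum_mul]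
  refine sum_congr rfl fun i hi => ?_
  rw [(mem_filter.1 hi).2]

theorem sum_patternCoeff (hπ : ∀ i, π i ∈ T) : ∑ t ∈ T, patternCoeff π t = 0 := by
  have := sum_patternCoeff_mul hπ fun _ => 1
  simp only [mul_one] at this
  rw [this, sum_copySign]

theorem sum_patternCoeff_mul_eq (hπ : ∀ i, π i ∈ T) {u : Fin k ⊕ Fin k → ℤ}
    (hu : u ∈ patternTuples k A Y T π β) :
    ∑ t ∈ T, patternCoeff π t * u t = -∑ i, copySign k i * β i := by
  obtain ⟨hb, hpat, -⟩ := mem_filter.1 hu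
  have h1 := (mem_filter.1 hb).2
  rw [sum_patternCoeff_mul hπ, eq_neg_iff_add_eq_zero, ← sum_add_distrib, ← h1]
  refine sum_congr rfl fun i _ => ?_
  rw [hpat i]; ring

theorem mem_Icc_of_mem_patternTuples {u : Fin k ⊕ Fin k → ℤ}
    (hu : u ∈ patternTuples k A Y T π β) (i : Fin k ⊕ Fin k) : u i ∈ Icc (0 : ℤ) Y :=
  Fintype.mem_piFinset.1 (mem_filter.1 (mem_filter.1 hu).1).1 i

theorem patternTuples_determined (hπ : ∀ i, π i ∈ T) {u v : Fin k ⊕ Fin k → ℤ}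
    (hu : u ∈ patternTuples k A Y T π β) (hv : v ∈ patternTuples k A Y T π β)
    (h : ∀ t ∈ T, u t = v t) : u = v := by
  funext i
  rw [(mem_filter.1 hu).2.1 i, (mem_filter.1 hv).2.1 i, h _ (hπ i)]

/-- A coordinate with nonzero coefficient is determined by the others. -/
theorem patternTuples_determined_erase (hπ : ∀ i, π i ∈ T) {t₀ : Fin k ⊕ Fin k} (ht₀ : t₀ ∈ T)
    (hc : patternCoeff π t₀ ≠ 0) {u v : Fin k ⊕ Fin k → ℤ}
    (hu : u ∈ patternTuples k A Y T π β) (hv : v ∈ patternTuples k A Y T π β)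
    (h : ∀ t ∈ T.erase t₀, u t = v t) : u = v := by
  refine patternTuples_determined hπ hu hv fun t ht => ?_
  by_cases htt : t = t₀
  · have h1 := sum_patternCoeff_mul_eq hπ hu
    have h2 := sum_patternCoeff_mul_eq hπ hv
    rw [← add_sum_erase T _ ht₀] at h1 h2
    rw [sum_congr rfl fun t ht => by rw [h t ht]] at h1
    have h3 : patternCoeff π t₀ * u t₀ = patternCoeff π t₀ * v t₀ := by linarith
    rw [htt]
    exact mul_left_cancel₀ hc h3
  · exact h t (mem_erase.2 ⟨htt, ht⟩)

/-- If the balancing equation of the pattern is void, each class of the pattern has at least two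
elements. -/
theorem card_le_of_patternCoeff_eq_zero (hπ : ∀ i, π i ∈ T) (hfix : ∀ t ∈ T, π t = t)
    (hc : ∀ t ∈ T, patternCoeff π t = 0) : T.card ≤ k := by
  have h1 := card_eq_sum_card_fiberwise (s := (univ : Finset (Fin k ⊕ Fin k))) (t := T) (f := π)
    fun i _ => hπ i
  have h2 : ∀ t ∈ T, 2 ≤ (univ.filter fun i => π i = t).card := by
    intro t ht
    by_contra hlt
    have hmem : t ∈ univ.filter fun i => π i = t := mem_filter.2 ⟨mem_univ _, hfix t ht⟩
    have hpos := card_pos.2 ⟨t, hmem⟩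
    obtain ⟨i, hi⟩ := card_eq_one.1 (by omega : (univ.filter fun i => π i = t).card = 1)
    have := hc t ht
    rw [patternCoeff, hi, sum_singleton] at this
    rcases i with i | i <;> simp [copySign] at this
  have h3 := card_nsmul_le_sum T _ 2 h2
  rw [← h1] at h3
  simp at h3
  omega

theorem abs_sum_copySign_mul_le (hβ : ∀ i, |β i| ≤ A) :
    |∑ i, copySign k i * β i| ≤ ((2 * k * A : ℕ) : ℤ) := by
  refine (abs_sum_le_sum_abs _ _).trans ((sum_le_card_nsmul _ _ (A : ℤ) fun i _ => ?_).trans ?_)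
  · rw [abs_mul]
    have : |copySign k i| = 1 := by rcases i with i | i <;> simp [copySign]
    rw [this, one_mul]; exact hβ i
  · simp; ring_nf; rfl

/-- The number of free parameters of a pattern is the number `|T|` of its classes, or `|T| - 1` if
the balancing equation is not void; the Euler factors are bounded on average over them. -/
theorem exists_sum_eulerPow_patternTuples_le (m : ℕ) (hπ : ∀ i, π i ∈ T)
    (hfix : ∀ t ∈ T, π t = t) (hβ : ∀ i, |β i| ≤ A) :
    ∃ d : ℕ, ((d = T.card ∧ T.card ≤ k) ∨ d + 1 = T.card) ∧
      ∃ C : ℝ, 0 < C ∧ ∀ H : ℝ, 2 ≤ H →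
        (((patternTuples k A ⌊H⌋₊ T π β).card : ℝ) ≤ C * H ^ d) ∧
        ∀ t ∈ T, ∀ t' ∈ T, ∀ e : ℤ, |e| ≤ A →
          ∑ u ∈ patternTuples k A ⌊H⌋₊ T π β, eulerPow m (u t - u t' + e) ≤ C * H ^ d := by
  have hcard : ∀ (H : ℝ) (R : Finset (Fin k ⊕ Fin k)), 2 ≤ H →
      (∀ u ∈ patternTuples k A ⌊H⌋₊ T π β, ∀ v ∈ patternTuples k A ⌊H⌋₊ T π β,
        (∀ i ∈ R, u i = v i) → u = v) →
      ((patternTuples k A ⌊H⌋₊ T π β).card : ℝ) ≤ 2 ^ R.card * H ^ R.card := by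
    intro H R hH hR
    have h1 := card_le_pow_of_determined (fun u hu => mem_Icc_of_mem_patternTuples hu) hR
    have h2 : ((patternTuples k A ⌊H⌋₊ T π β).card : ℝ) ≤ ((⌊H⌋₊ : ℝ) + 1) ^ R.card := by
      exact_mod_cast h1
    rw [← mul_pow]
    refine h2.trans (pow_le_pow_left₀ (by positivity) ?_ _)
    linarith [Nat.floor_le (by linarith : 0 ≤ H)]
  by_cases hc : ∀ t ∈ T, patternCoeff π t = 0
  · refine ⟨T.card, Or.inl ⟨rfl, card_le_of_patternCoeff_eq_zero hπ hfix hc⟩, ?_⟩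
    obtain ⟨C, hC, h⟩ := exists_sum_eulerPow_le_of_determined (ι := Fin k ⊕ Fin k) m A A T.card
    have hdet : ∀ H : ℝ, ∀ u ∈ patternTuples k A ⌊H⌋₊ T π β,
        ∀ v ∈ patternTuples k A ⌊H⌋₊ T π β, (∀ i ∈ T, u i = v i) → u = v :=
      fun H u hu v hv => patternTuples_determined hπ hu hv
    refine ⟨C + 2 ^ T.card, by positivity, fun H hH => ⟨?_, ?_⟩⟩
    · refine (hcard H T hH (hdet H)).trans ?_
      gcongr
      linarith
    · intro t ht t' ht' e he
      refine (h H hH _ T t t' e (fun u hu => mem_Icc_of_mem_patternTuples hu) (hdet H) rfl he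
        ?_).trans (by gcongr; linarith [pow_pos (zero_lt_two' ℝ) T.card])
      by_cases htt : t = t'
      · right; intro u _; rw [htt]; simpa using he
      · exact Or.inl ⟨ht, ht', htt⟩
  · push Not at hc
    obtain ⟨t₀, ht₀, hct₀⟩ := hc
    have hTpos := card_pos.2 ⟨t₀, ht₀⟩
    refine ⟨T.card - 1, Or.inr (by omega), ?_⟩
    obtain ⟨C, hC, h⟩ := exists_sum_eulerPow_le_of_determined (ι := Fin k ⊕ Fin k) m A
      (2 * k * A + A) (T.card - 1)
    have hdet : ∀ t₁ ∈ T, patternCoeff π t₁ ≠ 0 → ∀ H : ℝ, ∀ u ∈ patternTuples k A ⌊H⌋₊ T π β,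
        ∀ v ∈ patternTuples k A ⌊H⌋₊ T π β, (∀ i ∈ T.erase t₁, u i = v i) → u = v :=
      fun t₁ ht₁ hct₁ H u hu v hv => patternTuples_determined_erase hπ ht₁ hct₁ hu hv
    refine ⟨C + 2 ^ (T.card - 1), by positivity, fun H hH => ⟨?_, ?_⟩⟩
    · have h1 := hcard H (T.erase t₀) hH (hdet t₀ ht₀ hct₀ H)
      rw [card_erase_of_mem ht₀] at h1
      refine h1.trans ?_
      gcongr
      linarith
    · intro t ht t' ht' e he
      refine le_trans ?_ (by gcongr; linarith [pow_pos (zero_lt_two' ℝ) (T.card - 1)] :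
        C * H ^ (T.card - 1) ≤ (C + 2 ^ (T.card - 1)) * H ^ (T.card - 1))
      have happ : ∀ t₁ ∈ T, patternCoeff π t₁ ≠ 0 →
          ((t ∈ T.erase t₁ ∧ t' ∈ T.erase t₁ ∧ t ≠ t') ∨
            ∀ u ∈ patternTuples k A ⌊H⌋₊ T π β, |u t - u t' + e| ≤ ((2 * k * A + A : ℕ) : ℤ)) →
          ∑ u ∈ patternTuples k A ⌊H⌋₊ T π β, eulerPow m (u t - u t' + e) ≤
            C * H ^ (T.card - 1) := fun t₁ ht₁ hct₁ hor =>
        h H hH _ (T.erase t₁) t t' e (fun u hu => mem_Icc_of_mem_patternTuples hu)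
          (hdet t₁ ht₁ hct₁ H) (card_erase_of_mem ht₁) he hor
      by_cases htt : t = t'
      · refine happ t₀ ht₀ hct₀ (Or.inr fun u _ => ?_)
        rw [htt, sub_self, zero_add]
        push_cast
        have : (0 : ℤ) ≤ 2 * k * A := by positivity
        linarith
      by_cases hex : ∃ t₁ ∈ T, t₁ ≠ t ∧ t₁ ≠ t' ∧ patternCoeff π t₁ ≠ 0
      · obtain ⟨t₁, ht₁, h1, h2, hct₁⟩ := hex
        exact happ t₁ ht₁ hct₁
          (Or.inl ⟨mem_erase.2 ⟨h1.symm, ht⟩, mem_erase.2 ⟨h2.symm, ht'⟩, htt⟩)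
      -- Now the balancing equation reads `c * (u t - u t') = const`, so `u t - u t'` is bounded.
      · push Not at hex
        have hzero : ∀ x ∈ T, x ∉ ({t, t'} : Finset _) → patternCoeff π x = 0 := by
          intro x hx hxn
          rw [mem_insert, mem_singleton, not_or] at hxn
          exact hex x hx hxn.1 hxn.2
        have hpair : ({t, t'} : Finset _) ⊆ T := by
          intro x hx
          rw [mem_insert, mem_singleton] at hx
          rcases hx with rfl | rfl <;> assumption
        have hs : patternCoeff π t + patternCoeff π t' = 0 := by
          rw [← sum_patternCoeff hπ, ← sum_subset hpair hzero, sum_pair htt]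
        have hct : patternCoeff π t ≠ 0 := by
          intro h0
          by_cases h1 : t₀ ∈ ({t, t'} : Finset _)
          · rw [mem_insert, mem_singleton] at h1
            rcases h1 with rfl | rfl
            · exact hct₀ h0
            · apply hct₀; linarith
          · exact hct₀ (hzero t₀ ht₀ h1)
        refine happ t ht hct (Or.inr fun u hu => ?_)
        have h1 := sum_patternCoeff_mul_eq hπ hu
        rw [← sum_subset hpair fun x hx hxn => by rw [hzero x hx hxn, zero_mul],
          sum_pair htt] at h1
        have h2 : patternCoeff π t * (u t - u t') = -∑ i, copySign k i * β i := by
          rw [← h1, show patternCoeff π t' = -patternCoeff π t by linarith]; ring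
        have h3 : |u t - u t'| ≤ ((2 * k * A : ℕ) : ℤ) := by
          calc |u t - u t'| ≤ |patternCoeff π t| * |u t - u t'| :=
                le_mul_of_one_le_left (abs_nonneg _) (Int.one_le_abs hct)
            _ = |∑ i, copySign k i * β i| := by rw [← abs_mul, h2, abs_neg]
            _ ≤ _ := abs_sum_copySign_mul_le hβ
        refine (abs_add_le _ _).trans ?_
        push_cast at h3 ⊢
        linarith

end

end Patterns

/-! ### The bound for the moment -/

section Moment

open Finset

theorem prod_pow_le_one_add_sum {α : Type*} (O : Finset α) {g : α → ℝ} (hg : ∀ x ∈ O, 1 ≤ g x)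
    (s : ℕ) : (∏ x ∈ O, g x) ^ s ≤ 1 + ∑ x ∈ O, g x ^ (O.card * s) := by
  have hnn : ∀ x ∈ O, 0 ≤ g x ^ (O.card * s) := fun x hx =>
    pow_nonneg (zero_le_one.trans (hg x hx)) _
  rcases O.eq_empty_or_nonempty with rfl | hO
  · simp
  · obtain ⟨x, hx, hmax⟩ := exists_max_image O g hO
    have h1 : ∏ y ∈ O, g y ≤ g x ^ O.card := by
      rw [← prod_const]
      exact prod_le_prod (fun y hy => zero_le_one.trans (hg y hy)) hmax
    calc (∏ y ∈ O, g y) ^ s ≤ (g x ^ O.card) ^ s :=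
          pow_le_pow_left₀ (prod_nonneg fun y hy => zero_le_one.trans (hg y hy)) h1 s
      _ = g x ^ (O.card * s) := (pow_mul _ _ _).symm
      _ ≤ ∑ y ∈ O, g y ^ (O.card * s) := single_le_sum (f := fun y => g y ^ (O.card * s)) hnn hx
      _ ≤ _ := by linarith

/-- The correlation of tuples of shifts with the set `T` of well-separated coordinates: the other
coordinates are estimated trivially, by `(log X) ^ l` each. -/
theorem exists_sum_prod_tupleWeight_le {l k A : ℕ} (hl : 1 ≤ l) {a : Fin l → ℤ}
    (ha : Function.Injective a) (hA : ∀ j, 2 * |a j| ≤ A) {T : Finset (Fin k ⊕ Fin k)}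
    (hT : T.Nonempty) :
    ∃ m : ℕ, ∃ C : ℝ, 0 < C ∧ ∀ X : ℝ, 2 ≤ X → ∀ u : Fin k ⊕ Fin k → ℤ,
      (∀ i, (u i : ℝ) ≤ X) → (∀ t ∈ T, ∀ t' ∈ T, t ≠ t' → (A : ℤ) < |u t - u t'|) →
      ∑ n ∈ range ⌈X⌉₊, ∏ i, tupleWeight a (n + 1 + u i) ≤
        C * X * (Real.log X ^ l) ^ (2 * k - T.card) *
          (1 + ∑ t ∈ T, ∑ t' ∈ T, ∑ j, ∑ j', eulerPow m (u t - u t' + (a j - a j'))) := by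
  classical
  set s := T.card * l with hs
  have hs1 : 1 ≤ s := Nat.mul_pos (card_pos.2 hT) hl
  have hA0 : (0 : ℝ) ≤ A := Nat.cast_nonneg A
  obtain ⟨C, hC, hcorr⟩ := exists_sum_prod_vonMangoldtInt_le s hs1 (A + 2) (by linarith)
  obtain ⟨c₁, hc₁, hlog⟩ := exists_log_mul_le (A + 3) (by linarith)
  refine ⟨(s * s - s) * s, (c₁ ^ l) ^ (2 * k - T.card) * C, by positivity, ?_⟩
  intro X hX u huX hsep
  set m := (s * s - s) * s with hm
  have haA : ∀ j, (a j : ℝ) ≤ A := fun j => by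
    have h1 := hA j
    have h2 := le_abs_self (a j)
    have h3 := abs_nonneg (a j)
    have : a j ≤ (A : ℤ) := by linarith
    exact_mod_cast this
  set f : (Fin k ⊕ Fin k) × Fin l → ℤ := fun x => u x.1 + a x.2 + 1 with hf
  have hinj : Set.InjOn f (T ×ˢ (univ : Finset (Fin l)) : Finset _) := by
    rintro ⟨t, j⟩ hx ⟨t', j'⟩ hx' h
    simp only [coe_product, Set.mem_prod, mem_coe, mem_univ, and_true] at hx hx'
    simp only [hf] at h
    have htt : t = t' := by
      by_contra hne
      have h1 := hsep t hx t' hx' hne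
      rw [show u t - u t' = a j' - a j by linarith] at h1
      have h2 := abs_sub (a j') (a j)
      have h3 := hA j
      have h4 := hA j'
      linarith
    subst htt
    have : a j = a j' := by linarith
    rw [ha this]
  set B := (T ×ˢ (univ : Finset (Fin l))).image f with hB
  have hBcard : B.card = s := by
    rw [hB, card_image_of_injOn hinj, card_product, hs]; simp
  have hBX : ∀ b ∈ B, (b : ℝ) ≤ (A + 2) * X := by
    intro b hb
    obtain ⟨x, -, rfl⟩ := mem_image.1 hb
    have h1 := huX x.1
    have h2 := haA x.2
    simp only [hf]
    push_cast
    nlinarith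
  have hBprod : ∀ n : ℕ, ∏ b ∈ B, vonMangoldtInt ((n : ℤ) + b) =
      ∏ t ∈ T, tupleWeight a (n + 1 + u t) := fun n => by
    rw [hB, prod_image hinj, prod_product]
    refine prod_congr rfl fun t _ => prod_congr rfl fun j _ => ?_
    simp only [hf]
    congr 1
    ring
  have hlg0 : 0 ≤ Real.log X := Real.log_nonneg (by linarith)
  have htriv : ∀ n < ⌈X⌉₊, ∀ i, tupleWeight a (n + 1 + u i) ≤ c₁ ^ l * Real.log X ^ l := by
    intro n hn i
    rw [← mul_pow]
    have h1 := Nat.lt_ceil.1 hn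
    have h2 : ∀ j ∈ (univ : Finset (Fin l)),
        vonMangoldtInt ((n : ℤ) + 1 + u i + a j) ≤ c₁ * Real.log X := fun j _ => by
      refine (vonMangoldtInt_le_log ?_ ?_).trans (hlog X hX)
      · nlinarith
      · have h3 := huX i
        have h4 := haA j
        push_cast
        nlinarith
    refine (prod_le_prod (fun j _ => vonMangoldtInt_nonneg _) h2).trans ?_
    simp
  have hG : (∏ x ∈ B.offDiag, eulerFactor (x.1 - x.2)) ^ s ≤
      1 + ∑ t ∈ T, ∑ t' ∈ T, ∑ j, ∑ j', eulerPow m (u t - u t' + (a j - a j')) := by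
    refine (prod_pow_le_one_add_sum _ (fun x _ => one_le_eulerFactor _) s).trans ?_
    rw [offDiag_card, hBcard]
    gcongr 1 + ?_
    calc ∑ x ∈ B.offDiag, eulerFactor (x.1 - x.2) ^ m
        = ∑ x ∈ B.offDiag, eulerPow m (x.1 - x.2) := by
          refine sum_congr rfl fun x hx => ?_
          rw [eulerPow, if_neg (sub_ne_zero.2 (mem_offDiag.1 hx).2.2)]
      _ ≤ ∑ x ∈ B ×ˢ B, eulerPow m (x.1 - x.2) :=
          sum_le_sum_of_subset_of_nonneg (fun x hx => mem_product.2
            ⟨(mem_offDiag.1 hx).1, (mem_offDiag.1 hx).2.1⟩) fun x _ _ => eulerPow_nonneg _ _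
      _ = _ := by
          rw [sum_product, hB, sum_image hinj, sum_product]
          refine sum_congr rfl fun t _ => ?_
          simp only [sum_image hinj, sum_product]
          rw [sum_comm]
          refine sum_congr rfl fun t' _ => sum_congr rfl fun j _ => sum_congr rfl fun j' _ => ?_
          simp only [hf]
          congr 1
          ring
  have hterm : ∀ n ∈ range ⌈X⌉₊, ∏ i, tupleWeight a (n + 1 + u i) ≤
      (c₁ ^ l * Real.log X ^ l) ^ (2 * k - T.card) * ∏ b ∈ B, vonMangoldtInt ((n : ℤ) + b) := by
    intro n hn
    rw [hBprod, ← prod_sdiff (subset_univ T)]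
    refine mul_le_mul_of_nonneg_right ?_ (prod_nonneg fun t _ => tupleWeight_nonneg _ _)
    refine (prod_le_prod (fun i _ => tupleWeight_nonneg _ _)
      fun i _ => htriv n (mem_range.1 hn) i).trans (le_of_eq ?_)
    rw [prod_const, card_sdiff_of_subset (subset_univ T)]
    simp [two_mul]
  calc ∑ n ∈ range ⌈X⌉₊, ∏ i, tupleWeight a (n + 1 + u i)
      ≤ (c₁ ^ l * Real.log X ^ l) ^ (2 * k - T.card) *
        ∑ n ∈ range ⌈X⌉₊, ∏ b ∈ B, vonMangoldtInt ((n : ℤ) + b) := by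
        rw [mul_sum]; exact sum_le_sum hterm
    _ ≤ (c₁ ^ l * Real.log X ^ l) ^ (2 * k - T.card) * (C * X *
          (1 + ∑ t ∈ T, ∑ t' ∈ T, ∑ j, ∑ j', eulerPow m (u t - u t' + (a j - a j')))) := by
        refine mul_le_mul_of_nonneg_left ?_ (by positivity)
        refine (hcorr X hX B hBcard hBX).trans ?_
        exact mul_le_mul_of_nonneg_left hG (by positivity)
    _ = _ := by rw [mul_pow]; ring

/-- The contributions of patterns with `r` classes interpolate between the extreme ones. -/
theorem pow_mul_pow_le_of_pattern {H L : ℝ} (hH : 1 ≤ H) (hL : 0 ≤ L) {d r k : ℕ}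
    (hr : 1 ≤ r) (hrk : r ≤ 2 * k) (hd : (d = r ∧ r ≤ k) ∨ d + 1 = r) :
    L ^ (2 * k - r) * H ^ d ≤ H ^ (2 * k - 1) + H ^ k * L ^ k + H * L ^ (2 * k - 1) := by
  have hH0 : 0 ≤ H := by linarith
  have t1 : 0 ≤ H ^ (2 * k - 1) := by positivity
  have t2 : 0 ≤ H ^ k * L ^ k := by positivity
  have t3 : 0 ≤ H * L ^ (2 * k - 1) := by positivity
  rcases le_total L H with hLH | hLH
  · rcases hd with ⟨rfl, hk⟩ | hd
    · have : L ^ (2 * k - d) * H ^ d ≤ H ^ k * L ^ k := by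
        calc L ^ (2 * k - d) * H ^ d = L ^ (k - d) * (L ^ k * H ^ d) := by
              rw [← mul_assoc, ← pow_add]; congr 2; omega
          _ ≤ H ^ (k - d) * (L ^ k * H ^ d) := by gcongr
          _ = (H ^ (k - d) * H ^ d) * L ^ k := by ring
          _ = H ^ k * L ^ k := by rw [← pow_add]; congr 2; omega
      linarith
    · have : L ^ (2 * k - r) * H ^ d ≤ H ^ (2 * k - 1) := by
        calc L ^ (2 * k - r) * H ^ d ≤ H ^ (2 * k - r) * H ^ d := by gcongr
          _ = H ^ (2 * k - 1) := by rw [← pow_add]; congr 1; omega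
      linarith
  · have : L ^ (2 * k - r) * H ^ d ≤ H * L ^ (2 * k - 1) := by
      have hd' : H ^ d ≤ H * H ^ (r - 1) := by
        rw [← pow_succ']
        exact pow_le_pow_right₀ hH (by omega)
      calc L ^ (2 * k - r) * H ^ d ≤ L ^ (2 * k - r) * (H * L ^ (r - 1)) := by
            refine mul_le_mul_of_nonneg_left (hd'.trans ?_) (by positivity)
            gcongr
        _ = H * (L ^ (2 * k - r) * L ^ (r - 1)) := by ring
        _ = H * L ^ (2 * k - 1) := by rw [← pow_add]; congr 2; omega
    linarith

theorem exists_sum_patternTuples_le {l k A : ℕ} (hl : 1 ≤ l) {a : Fin l → ℤ}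
    (ha : Function.Injective a) (hA : ∀ j, 2 * |a j| ≤ A) {T : Finset (Fin k ⊕ Fin k)}
    (hT : T.Nonempty) {π : Fin k ⊕ Fin k → Fin k ⊕ Fin k} {β : Fin k ⊕ Fin k → ℤ}
    (hπ : ∀ i, π i ∈ T) (hfix : ∀ t ∈ T, π t = t) (hβ : ∀ i, |β i| ≤ A) :
    ∃ C : ℝ, 0 < C ∧ ∀ X H : ℝ, 2 ≤ H → H ≤ X →
      ∑ u ∈ patternTuples k A ⌊H⌋₊ T π β, ∑ n ∈ range ⌈X⌉₊, ∏ i, tupleWeight a (n + 1 + u i) ≤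
        C * (X * (H ^ (2 * k - 1) + H ^ k * (Real.log X ^ l) ^ k +
          H * (Real.log X ^ l) ^ (2 * k - 1))) := by
  obtain ⟨m, C₁, hC₁, h₁⟩ := exists_sum_prod_tupleWeight_le hl ha hA hT
  obtain ⟨d, hd, C₂, hC₂, h₂⟩ := exists_sum_eulerPow_patternTuples_le m hπ hfix hβ
  have hTk : T.card ≤ 2 * k := by
    have := card_le_univ T
    simp at this
    omega
  set c : ℝ := 1 + T.card * T.card * l * l with hc
  refine ⟨C₁ * (C₂ * c), by positivity, ?_⟩
  intro X H hH hHX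
  have hX : 2 ≤ X := hH.trans hHX
  set L := Real.log X ^ l with hL
  have hL0 : 0 ≤ L := pow_nonneg (Real.log_nonneg (by linarith)) l
  set S := patternTuples k A ⌊H⌋₊ T π β with hS
  have hdiff : ∀ j j', |a j - a j'| ≤ A := fun j j' => by
    have h1 := abs_sub (a j) (a j')
    have h2 := hA j
    have h3 := hA j'
    linarith
  have hsum : ∑ u ∈ S, (1 + ∑ t ∈ T, ∑ t' ∈ T, ∑ j, ∑ j',
      eulerPow m (u t - u t' + (a j - a j'))) ≤ C₂ * H ^ d * c := by
    rw [sum_add_distrib, hc, mul_add]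
    refine add_le_add (by simpa using (h₂ H hH).1) ?_
    rw [sum_comm]
    calc ∑ t ∈ T, ∑ u ∈ S, ∑ t' ∈ T, ∑ j, ∑ j', eulerPow m (u t - u t' + (a j - a j'))
        = ∑ t ∈ T, ∑ t' ∈ T, ∑ j, ∑ j', ∑ u ∈ S, eulerPow m (u t - u t' + (a j - a j')) := by
          refine sum_congr rfl fun t _ => ?_
          rw [sum_comm]
          refine sum_congr rfl fun t' _ => ?_
          rw [sum_comm]
          refine sum_congr rfl fun j _ => ?_
          rw [sum_comm]
      _ ≤ ∑ t ∈ T, ∑ t' ∈ T, ∑ j : Fin l, ∑ j' : Fin l, C₂ * H ^ d :=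
          sum_le_sum fun t ht => sum_le_sum fun t' ht' => sum_le_sum fun j _ =>
            sum_le_sum fun j' _ => (h₂ H hH).2 t ht t' ht' _ (hdiff j j')
      _ = _ := by simp; ring
  calc ∑ u ∈ S, ∑ n ∈ range ⌈X⌉₊, ∏ i, tupleWeight a (n + 1 + u i)
      ≤ ∑ u ∈ S, C₁ * X * L ^ (2 * k - T.card) *
          (1 + ∑ t ∈ T, ∑ t' ∈ T, ∑ j, ∑ j', eulerPow m (u t - u t' + (a j - a j'))) := by
        refine sum_le_sum fun u hu => h₁ X hX u (fun i => ?_) (mem_filter.1 hu).2.2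
        have h3 := (mem_Icc.1 (mem_Icc_of_mem_patternTuples hu i)).2
        have h4 : (u i : ℝ) ≤ (⌊H⌋₊ : ℝ) := by exact_mod_cast h3
        exact (h4.trans (Nat.floor_le (by linarith))).trans hHX
    _ ≤ C₁ * X * L ^ (2 * k - T.card) * (C₂ * H ^ d * c) := by
        rw [← mul_sum]
        exact mul_le_mul_of_nonneg_left hsum (by positivity)
    _ = C₁ * (C₂ * c) * (X * (L ^ (2 * k - T.card) * H ^ d)) := by ring
    _ ≤ _ := by
        refine mul_le_mul_of_nonneg_left ?_ (by positivity)
        refine mul_le_mul_of_nonneg_left ?_ (by linarith)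
        exact pow_mul_pow_le_of_pattern (by linarith) hL0 (card_pos.2 hT) hTk hd

/-- Every tuple has a pattern `(T, π, β)` with `|β| ≤ A`. -/
theorem exists_mem_patternTuples {k A Y : ℕ} (hk : 1 ≤ k) {u : Fin k ⊕ Fin k → ℤ}
    (hu : u ∈ balancedTuples k Y) :
    ∃ (T : Finset (Fin k ⊕ Fin k)) (π : Fin k ⊕ Fin k → Fin k ⊕ Fin k) (β : Fin k ⊕ Fin k → ℤ),
      (T.Nonempty ∧ (∀ i, π i ∈ T) ∧ (∀ t ∈ T, π t = t) ∧ ∀ i, |β i| ≤ A) ∧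
        u ∈ patternTuples k A Y T π β := by
  classical
  obtain ⟨T, hsep, hcov⟩ := exists_separated_representatives A u
  choose ρ hρT hρ using hcov
  refine ⟨T, fun i => if i ∈ T then i else ρ i,
    fun i => u i - u (if i ∈ T then i else ρ i), ⟨?_, ?_, ?_, ?_⟩, ?_⟩
  · exact ⟨_, hρT (Sum.inl ⟨0, hk⟩)⟩
  · intro i
    dsimp only
    split_ifs with h
    · exact h
    · exact hρT i
  · intro t ht
    simp [ht]
  · intro i
    dsimp only
    split_ifs
    · simp
    · exact hρ i
  · exact mem_filter.2 ⟨hu, fun i => by ring, hsep⟩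

theorem exists_shortExpSumMoment_le {l k : ℕ} (hl : 1 ≤ l) (hk : 1 ≤ k) {a : Fin l → ℤ}
    (ha : Function.Injective a) :
    ∃ C : ℝ, 0 < C ∧ ∀ (X H : ℝ) (g : ℤ → ℂ), 2 ≤ H → H ≤ X → (∀ n, ‖g n‖ ≤ 1) →
      shortExpSumMoment a g k X H ≤ C * (X * (H ^ (2 * k - 1) + H ^ k * (Real.log X ^ l) ^ k +
        H * (Real.log X ^ l) ^ (2 * k - 1))) := by
  classical
  set A : ℕ := ∑ j, 2 * (a j).natAbs with hAdef
  have hA : ∀ j, 2 * |a j| ≤ A := fun j => by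
    have h1 : 2 * (a j).natAbs ≤ A :=
      single_le_sum (f := fun j => 2 * (a j).natAbs) (fun _ _ => Nat.zero_le _) (mem_univ j)
    rw [Int.abs_eq_natAbs]
    exact_mod_cast h1
  set J := ((univ : Finset (Finset (Fin k ⊕ Fin k))) ×ˢ
    (univ : Finset (Fin k ⊕ Fin k → Fin k ⊕ Fin k)) ×ˢ
    Fintype.piFinset fun _ : Fin k ⊕ Fin k => Icc (-(A : ℤ)) A).filter
      (fun x => x.1.Nonempty ∧ (∀ i, x.2.1 i ∈ x.1) ∧ (∀ t ∈ x.1, x.2.1 t = t) ∧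
        ∀ i, |x.2.2 i| ≤ (A : ℤ)) with hJ
  have hex : ∀ x : Finset (Fin k ⊕ Fin k) × (Fin k ⊕ Fin k → Fin k ⊕ Fin k) ×
      (Fin k ⊕ Fin k → ℤ), ∃ C : ℝ, 0 < C ∧ (x ∈ J → ∀ X H : ℝ, 2 ≤ H → H ≤ X →
      ∑ u ∈ patternTuples k A ⌊H⌋₊ x.1 x.2.1 x.2.2,
        ∑ n ∈ range ⌈X⌉₊, ∏ i, tupleWeight a (n + 1 + u i) ≤
        C * (X * (H ^ (2 * k - 1) + H ^ k * (Real.log X ^ l) ^ k +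
          H * (Real.log X ^ l) ^ (2 * k - 1)))) := by
    intro x
    by_cases hx : x ∈ J
    · obtain ⟨h1, h2, h3, h4⟩ := (mem_filter.1 hx).2
      obtain ⟨C, hC, h⟩ := exists_sum_patternTuples_le hl ha hA h1 h2 h3 h4
      exact ⟨C, hC, fun _ => h⟩
    · exact ⟨1, one_pos, fun h => absurd h hx⟩
  choose C hC h using hex
  refine ⟨∑ x ∈ J, C x + 1, add_pos_of_nonneg_of_pos (sum_nonneg fun x _ => (hC x).le) one_pos, ?_⟩
  intro X H g hH hHX hg
  set E : (Fin k ⊕ Fin k → ℤ) → ℝ := fun u =>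
    ∑ n ∈ range ⌈X⌉₊, ∏ i, tupleWeight a (n + 1 + u i) with hE
  have hE0 : ∀ u, 0 ≤ E u := fun u => sum_nonneg fun n _ => prod_nonneg fun i _ =>
    tupleWeight_nonneg _ _
  set R := X * (H ^ (2 * k - 1) + H ^ k * (Real.log X ^ l) ^ k +
    H * (Real.log X ^ l) ^ (2 * k - 1)) with hR
  have hlg0 : 0 ≤ Real.log X := Real.log_nonneg (by linarith)
  have hX0 : 0 ≤ X := by linarith
  have hR0 : 0 ≤ R := by positivity
  calc shortExpSumMoment a g k X H ≤ ∑ u ∈ balancedTuples k ⌊H⌋₊, E u :=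
        shortExpSumMoment_le a g k hX0 (by linarith) hg
    _ ≤ ∑ u ∈ balancedTuples k ⌊H⌋₊, ∑ x ∈ J,
          if u ∈ patternTuples k A ⌊H⌋₊ x.1 x.2.1 x.2.2 then E u else 0 := by
        refine sum_le_sum fun u hu => ?_
        obtain ⟨T, π, β, hpat, hmem⟩ := exists_mem_patternTuples (A := A) hk hu
        have hxJ : (T, π, β) ∈ J := by
          refine mem_filter.2 ⟨?_, hpat⟩
          simp only [mem_product, mem_univ, true_and, Fintype.mem_piFinset, mem_Icc]
          exact fun i => abs_le.1 (hpat.2.2.2 i)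
        refine le_trans (by rw [if_pos hmem]) (single_le_sum (f := fun x : Finset (Fin k ⊕ Fin k) ×
          (Fin k ⊕ Fin k → Fin k ⊕ Fin k) × (Fin k ⊕ Fin k → ℤ) =>
          if u ∈ patternTuples k A ⌊H⌋₊ x.1 x.2.1 x.2.2 then E u else 0) (fun x _ => ?_) hxJ)
        split_ifs
        · exact hE0 u
        · exact le_rfl
    _ = ∑ x ∈ J, ∑ u ∈ patternTuples k A ⌊H⌋₊ x.1 x.2.1 x.2.2, E u := by
        rw [sum_comm]
        refine sum_congr rfl fun x _ => ?_
        rw [← sum_filter]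
        refine sum_congr ?_ fun _ _ => rfl
        ext u
        rw [mem_filter]
        exact ⟨fun h => h.2, fun h => ⟨(mem_filter.1 h).1, h⟩⟩
    _ ≤ ∑ x ∈ J, C x * R := sum_le_sum fun x hx => h x hx X H hH hHX
    _ = (∑ x ∈ J, C x) * R := by rw [sum_mul]
    _ ≤ _ := by gcongr; linarith

/-- In the range `H ≥ L ^ (k / (k - 1))` the first term of the bound dominates. -/
theorem moment_terms_le {H L : ℝ} {k : ℕ} (hk : 2 ≤ k) (hH : 1 ≤ H) (hL : 0 ≤ L)
    (h : L ^ k ≤ H ^ (k - 1)) :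
    H ^ (2 * k - 1) + H ^ k * L ^ k + H * L ^ (2 * k - 1) ≤ 3 * H ^ (2 * k - 1) := by
  have hH0 : 0 ≤ H := by linarith
  have h1 : H ^ k * L ^ k ≤ H ^ (2 * k - 1) := by
    calc H ^ k * L ^ k ≤ H ^ k * H ^ (k - 1) := by gcongr
      _ = _ := by rw [← pow_add]; congr 1; omega
  have h2 : H * L ^ (2 * k - 1) ≤ H ^ (2 * k - 1) := by
    rcases le_total L 1 with hL1 | hL1
    · calc H * L ^ (2 * k - 1) ≤ H * 1 := by gcongr; exact pow_le_one₀ hL hL1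
        _ ≤ H ^ (2 * k - 1) := by rw [mul_one]; exact le_self_pow₀ hH (by omega)
    · calc H * L ^ (2 * k - 1) ≤ H * L ^ (k * 2) := by
            gcongr 1
            exact pow_le_pow_right₀ hL1 (by omega)
        _ = H * (L ^ k) ^ 2 := by rw [pow_mul]
        _ ≤ H * (H ^ (k - 1)) ^ 2 := by gcongr
        _ = _ := by rw [← pow_mul, ← pow_succ']; congr 1; omega
  linarith

end Moment

theorem proposition2p6 (l k : ℕ) (hl : 1 ≤ l) (hk : 2 ≤ k)
    (a : Fin l → ℤ) (ha : Function.Injective a) :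
    ∃ C : ℝ, 0 < C ∧ ∀ (X H : ℝ) (g : ℤ → ℂ), 2 ≤ H → H ≤ X → (∀ n, ‖g n‖ ≤ 1) →
      shortExpSumMoment a g k X H ≤
          C * (X * (H ^ (2 * k - 1) + H ^ k * Real.log X ^ (k * l)
            + H * Real.log X ^ ((2 * k - 1) * l))) ∧
      (Real.log X ^ (((l : ℝ) * (k : ℝ)) / ((k : ℝ) - 1)) ≤ H →
        shortExpSumMoment a g k X H ≤ C * (X * H ^ (2 * k - 1))) := by
  obtain ⟨C, hC, h⟩ := exists_shortExpSumMoment_le hl (by omega : 1 ≤ k) ha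
  refine ⟨3 * C, by positivity, fun X H g hH hHX hg => ?_⟩
  have hM := h X H g hH hHX hg
  have hlg0 : 0 ≤ Real.log X := Real.log_nonneg (by linarith)
  have hX0 : 0 ≤ X := by linarith
  have hH0 : 0 ≤ H := by linarith
  constructor
  · refine hM.trans ?_
    rw [← pow_mul, ← pow_mul, mul_comm l k, mul_comm l (2 * k - 1)]
    refine mul_le_mul_of_nonneg_right (by linarith) (by positivity)
  · intro hHlog
    have hk1 : (0 : ℝ) < (k : ℝ) - 1 := by
      have : (2 : ℝ) ≤ k := by exact_mod_cast hk
      linarith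
    have hpow : (Real.log X ^ l) ^ k ≤ H ^ (k - 1) := by
      have h1 := pow_le_pow_left₀ (Real.rpow_nonneg hlg0 _) hHlog (k - 1)
      refine le_trans (le_of_eq ?_) h1
      rw [← pow_mul, ← Real.rpow_natCast, ← Real.rpow_natCast, ← Real.rpow_mul hlg0]
      congr 1
      push_cast [Nat.cast_sub (by omega : 1 ≤ k)]
      field_simp
    calc shortExpSumMoment a g k X H ≤ _ := hM
      _ ≤ C * (X * (3 * H ^ (2 * k - 1))) := by
          gcongr
          exact moment_terms_le hk (by linarith) (pow_nonneg hlg0 l) hpow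
      _ = _ := by ring
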